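/- All graphs are finite and simple, and the girth of a graph is the length of a shortest cycle ($\infty$ if there are no cycles). Let $G$ be a graph and $f \colon V(G) \to \mathbb{N} = \{0,1,2,\dots\}$. For $u \in V(G)$, the operation $\mathrm{Delete}(G,f,u)$ outputs the graph $G-u$ and the function $f' \colon V(G-u) \to \mathbb{Z}$ with $f'(v) = f(v)-1$ if $uv \in E(G)$ and $f'(v) = f(v)$ otherwise; it is legal if $f' \ge 0$. For adjacent $u, w \in V(G)$, the operation $\mathrm{DelSave}(G,f,u,w)$ outputs $G-u$ and the function $f' \colon V(G-u) \to \mathbb{Z}$ with $f'(v) = f(v)-1$ if $uv \in E(G)$ and $v \ne w$, and $f'(v) = f(v)$ otherwise; it is legal if $f(u) > f(w)$ and $f' \ge 0$. The graph $G$ is weakly $f$-degenerate if all its vertices can be removed by a sequence of legal applications of these two operations, starting from $(G,f)$. The weak degeneracy $\mathsf{wd}(G)$ is the minimum $d \in \mathbb{N}$ such that $G$ is weakly degenerate with respect to the constant function $d$. **Theorem.** There exist $c > 0$ and $d_0 \in \mathbb{N}$ such that if $G$ is a graph of maximum degree $d \ge d_0$ and girth at least $5$, then $\mathsf{wd}(G)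 \le d - c\sqrt{d}$. -/

import Mathlib

namespace WeakDegeneracy

variable {V : Type*}

open Classical in
/-- The function produced by the operation `Delete(G, f, u)`: every neighbour of `u` loses `1`. -/
noncomputable def deleteFun (G : SimpleGraph V) (f : V → ℤ) (u : V) : V → ℤ :=
  fun v => if G.Adj u v then f v - 1 else f v

open Classical in
/-- The function produced by the operation `DelSave(G, f, u, w)`: every neighbour of `u` other
than `w` loses `1`. -/
noncomputable def delSaveFun (G : SimpleGraph V) (f : V → ℤ) (u w : V) : V → ℤ :=
  fun v => if G.Adj u v ∧ v ≠ w then f v - 1 else f v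

/-- One legal application of `Delete` or `DelSave`. A state `(S, f)` stands for the induced subgraph
`G[S]` on the vertices not yet removed together with the restriction of `f` to `S`; the values of
`f` outside `S` play no role. -/
inductive LegalStep (G : SimpleGraph V) : Set V × (V → ℤ) → Set V × (V → ℤ) → Prop
  | delete (S : Set V) (f : V → ℤ) (u : V) (hu : u ∈ S)
      (hnonneg : ∀ v ∈ S \ {u}, 0 ≤ deleteFun G f u v) :
      LegalStep G (S, f) (S \ {u}, deleteFun G f u)
  | delSave (S : Set V) (f : V → ℤ) (u w : V) (hu : u ∈ S) (hw : w ∈ S) (huw : G.Adj u w)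
      (hlt : f w < f u) (hnonneg : ∀ v ∈ S \ {u}, 0 ≤ delSaveFun G f u w v) :
      LegalStep G (S, f) (S \ {u}, delSaveFun G f u w)

/-- `G` is weakly `f`-degenerate: all vertices can be removed by a finite sequence of legal
applications of `Delete` and `DelSave`, starting from `(G, f)`. -/
def IsWeaklyDegenerate (G : SimpleGraph V) (f : V → ℕ) : Prop :=
  ∃ g : V → ℤ, Relation.ReflTransGen (LegalStep G) (Set.univ, fun v => (f v : ℤ)) (∅, g)

/-- The weak degeneracy of `G`: the least `d` such that `G` is weakly degenerate with respect to
the constant function `d`. For finite graphs this minimum exists, see `isLeast_weakDegeneracy`. -/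
noncomputable def weakDegeneracy (G : SimpleGraph V) : ℕ :=
  sInf {d : ℕ | IsWeaklyDegenerate G (fun _ => d)}

theorem exists_removal (G : SimpleGraph V) (n : ℕ) :
    ∀ (S : Set V) (f : V → ℤ), S.Finite → S.ncard = n → (∀ v ∈ S, (n : ℤ) ≤ f v) →
      ∃ g : V → ℤ, Relation.ReflTransGen (LegalStep G) (S, f) (∅, g) := by
  induction n with
  | zero =>
    intro S f hS hn _
    rw [Set.ncard_eq_zero hS] at hn
    subst hn
    exact ⟨f, Relation.ReflTransGen.refl⟩
  | succ n ih =>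
    intro S f hS hn hf
    obtain ⟨u, hu⟩ : S.Nonempty := by
      rw [← Set.ncard_pos hS]
      omega
    have key : ∀ v ∈ S \ {u}, (n : ℤ) ≤ deleteFun G f u v := by
      intro v hv
      have h := hf v hv.1
      push_cast at h
      unfold deleteFun
      split_ifs <;> omega
    obtain ⟨g, hg⟩ := ih (S \ {u}) (deleteFun G f u) (hS.subset Set.sdiff_subset)
      (by rw [Set.ncard_sdiff_singleton_of_mem hu]; omega) key
    exact ⟨g, Relation.ReflTransGen.head
      (LegalStep.delete S f u hu fun v hv => le_trans (by positivity) (key v hv)) hg⟩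

theorem isLeast_weakDegeneracy [Finite V] (G : SimpleGraph V) :
    IsLeast {d : ℕ | IsWeaklyDegenerate G (fun _ => d)} (weakDegeneracy G) := by
  have hne : {d : ℕ | IsWeaklyDegenerate G (fun _ => d)}.Nonempty :=
    ⟨(Set.univ : Set V).ncard, exists_removal G _ Set.univ _ Set.finite_univ rfl fun _ _ => le_rfl⟩
  exact ⟨Nat.sInf_mem hne, fun _ hd => Nat.sInf_le hd⟩

end WeakDegeneracy

/-! Write `D = d - k` with `k` of order `√d`. A vertex with at most `D` neighbours in the current
induced subgraph can always be removed last, so only induced subgraphs of minimum degree above `D`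
matter (`removal_of_core`); these are nearly `d`-regular.

There, give each vertex a uniform random time in `{0, …, d - 1}` and postpone a sparse random set
`B` to the end. A vertex outside `B` with at least `k` neighbours in `B` has lost at most `d - k`
when its turn comes. A vertex of `B` loses all its neighbours, so it must be saved `k` times.

Saving `w` by `u` is legal when `w` has already lost more than `u`. At time `t` each has lost about
`t` neighbours, with fluctuations of order `√d`. With probability bounded below, `w` is ahead of its
mean by a multiple of `√d` at the times of linearly many of its neighbours (`le_pr_good`); only such
`w` enter `B`. The surplus absorbs the few neighbours of `w` that lie in `B` and the saves already
made. A constant proportion of those neighbours `u` have themselves lost no more than their mean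
(`pr_few_useful_le`), so `w` has linearly many possible savers. A saver serves one vertex only, but
it is a candidate for `O(√d)` elements of `B`, so Hall's theorem yields `k` private savers for each
(`exists_disjoint_candidates`).

Girth at least five makes the neighbourhoods of distinct neighbours of a vertex disjoint apart from
that vertex. The relevant events are therefore independent, Chernoff bounds give exponentially small
failure probabilities, and the local lemma handles all vertices at once
(`IsNearRegular.exists_times`). -/

namespace WeakDegeneracy

open Finset
open scoped Classical

/-! ### Removal orders, saving maps and reduction to the core. -/

section Removal

variable {V : Type*}

/-- The budget left at `v` after removing the vertices in `R` from the constant budget `D`, where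
`σ x = some v` means that the removal of `x` saves `v`. -/
noncomputable def budget (G : SimpleGraph V) (D : ℤ) (σ : V → Option V) (R : Finset V) (v : V) : ℤ :=
  D - #{x ∈ R | G.Adj x v ∧ σ x ≠ some v}

theorem budget_anti (G : SimpleGraph V) (D : ℤ) (σ : V → Option V) {R R' : Finset V}
    (h : R ⊆ R') (v : V) : budget G D σ R' v ≤ budget G D σ R v := by
  unfold budget
  have := card_le_card (filter_subset_filter (fun x => G.Adj x v ∧ σ x ≠ some v) h)
  omega

/-- With `σ` fixed in advance, the current function depends only on the set of removed vertices, not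
on their order. This and `delSaveFun_budget` reduce legality to counting. -/
theorem deleteFun_budget (G : SimpleGraph V) (D : ℤ) (σ : V → Option V) {R : Finset V} {u : V}
    (hu : u ∉ R) (hσ : σ u = none) :
    deleteFun G (budget G D σ R) u = budget G D σ (insert u R) := by
  funext v
  unfold deleteFun budget
  rw [filter_insert]
  by_cases h : G.Adj u v
  · simp [h, hσ, hu]; ring
  · simp [h]

theorem delSaveFun_budget (G : SimpleGraph V) (D : ℤ) (σ : V → Option V) {R : Finset V} {u w : V}
    (hu : u ∉ R) (hσ : σ u = some w) :
    delSaveFun G (budget G D σ R) u w = budget G D σ (insert u R) := by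
  funext v
  unfold delSaveFun budget
  rw [filter_insert]
  by_cases h : G.Adj u v ∧ v ≠ w
  · have h2 : G.Adj u v ∧ σ u ≠ some v := ⟨h.1, by simpa [hσ] using h.2.symm⟩
    rw [if_pos h, if_pos h2, card_insert_of_notMem (by simp [hu])]
    push_cast; ring
  · have h2 : ¬ (G.Adj u v ∧ σ u ≠ some v) := by
      rintro ⟨h3, h4⟩
      exact h ⟨h3, fun e => h4 (by rw [hσ, e])⟩
    rw [if_neg h, if_neg h2]

/-- A removal order `r` together with a saving map `σ` removes all of `S` legally as soon as every
vertex has a nonnegative budget, and every saved vertex a smaller budget than its saver, at the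
moments of removal. -/
theorem removal_of_order {L : Type*} [LinearOrder L] (G : SimpleGraph V) (D : ℤ)
    (σ : V → Option V) (S : Finset V) (r : V → L) (hr : Set.InjOn r S)
    (hσ : ∀ u ∈ S, ∀ w, σ u = some w → w ∈ S ∧ G.Adj u w ∧ r u < r w ∧
      budget G D σ {x ∈ S | r x < r u} w < budget G D σ {x ∈ S | r x < r u} u)
    (hnn : ∀ v ∈ S, 0 ≤ budget G D σ {x ∈ S | r x < r v} v) :
    ∃ g : V → ℤ, Relation.ReflTransGen (LegalStep G) ((S : Set V), fun _ => D) (∅, g) := by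
  -- Invariant: `R` is an initial segment of the order, so for the next vertex `u` it equals `{x ∈ S
  -- | r x < r u}`, the set in the hypotheses.
  suffices H : ∀ n : ℕ, ∀ R ⊆ S, #(S \ R) = n → (∀ x ∈ R, ∀ y ∈ S \ R, r x < r y) →
      ∃ g : V → ℤ, Relation.ReflTransGen (LegalStep G)
        (((S \ R : Finset V) : Set V), budget G D σ R) (∅, g) by
    have h0 := H _ ∅ (empty_subset _) rfl (by simp)
    have hb : budget G D σ ∅ = fun _ => D := by funext v; simp [budget]
    rwa [hb, sdiff_empty] at h0
  intro n
  induction n with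
  | zero =>
    intro R _ hn _
    rw [card_eq_zero] at hn
    rw [hn]
    exact ⟨_, by simpa using Relation.ReflTransGen.refl⟩
  | succ n ih =>
    intro R hR hn hlt
    obtain ⟨u, hu, humin⟩ := exists_min_image (S \ R) r (card_pos.mp (by omega))
    have huS := (mem_sdiff.mp hu).1
    have huR := (mem_sdiff.mp hu).2
    have hmin : ∀ y ∈ S \ R, y ≠ u → r u < r y := fun y hy hne =>
      lt_of_le_of_ne (humin y hy) fun e => hne (hr (mem_sdiff.mp hy).1 huS e.symm)
    have hRu : ({x ∈ S | r x < r u} : Finset V) = R := by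
      ext x
      simp only [mem_filter]
      constructor
      · rintro ⟨hx, hxu⟩
        by_contra hxR
        exact absurd (humin x (mem_sdiff.mpr ⟨hx, hxR⟩)) (not_le.mpr hxu)
      · exact fun hx => ⟨hR hx, hlt x hx u hu⟩
    have hset : S \ insert u R = (S \ R).erase u := by
      ext x; simp only [mem_sdiff, mem_insert, mem_erase]; tauto
    have hcoe : ((S \ insert u R : Finset V) : Set V) = ((S \ R : Finset V) : Set V) \ {u} := by
      rw [hset, coe_erase]
    -- Budgets only decrease, so nonnegativity at the removal of `v` itself implies it at every
    -- earlier moment.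
    have hpos : ∀ v ∈ ((S \ R : Finset V) : Set V) \ {u}, 0 ≤ budget G D σ (insert u R) v := by
      intro v hv
      have hv' : v ∈ S \ R := by exact_mod_cast hv.1
      have huv := hmin v hv' hv.2
      refine (hnn v (mem_sdiff.mp hv').1).trans (budget_anti G D σ ?_ v)
      intro x hx
      rw [mem_filter]
      rcases mem_insert.mp hx with rfl | hx
      · exact ⟨huS, huv⟩
      · exact ⟨hR hx, hlt x hx v hv'⟩
    obtain ⟨g, hg⟩ := ih (insert u R) (insert_subset huS hR)
      (by rw [hset, card_erase_of_mem hu]; omega) (by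
        intro x hx y hy
        have hy' : y ∈ S \ R ∧ y ≠ u := by rw [hset, mem_erase] at hy; exact ⟨hy.2, hy.1⟩
        rcases mem_insert.mp hx with rfl | hx
        · exact hmin y hy'.1 hy'.2
        · exact hlt x hx y hy'.1)
    refine ⟨g, Relation.ReflTransGen.head ?_ hg⟩
    rw [hcoe]
    cases hs : σ u with
    | none =>
      rw [← deleteFun_budget G D σ huR hs]
      exact LegalStep.delete _ _ u (by exact_mod_cast hu)
        (by rw [deleteFun_budget G D σ huR hs]; exact hpos)
    | some w =>
      obtain ⟨hwS, hadj, hrw, hlt'⟩ := hσ u huS w hs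
      rw [hRu] at hlt'
      have hwR : w ∈ S \ R := by
        rw [← hRu]
        simp [hwS, hrw.le]
      rw [← delSaveFun_budget G D σ huR hs]
      exact LegalStep.delSave _ _ u w (by exact_mod_cast hu) (by exact_mod_cast hwR) hadj hlt'
        (by rw [delSaveFun_budget G D σ huR hs]; exact hpos)

/-- A vertex whose budget is at least its number of remaining neighbours can be removed last. -/
theorem removal_insert [Finite V] (G : SimpleGraph V) (v : V) (s : Set V × (V → ℤ)) (g : V → ℤ)
    (h : Relation.ReflTransGen (LegalStep G) s (∅, g)) (hv : v ∉ s.1)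
    (hf : ({x ∈ s.1 | G.Adj x v}.ncard : ℤ) ≤ s.2 v) :
    ∃ g' : V → ℤ, Relation.ReflTransGen (LegalStep G) (insert v s.1, s.2) (∅, g') := by
  induction h using Relation.ReflTransGen.head_induction_on with
  | refl =>
    refine ⟨deleteFun G g v, Relation.ReflTransGen.single ?_⟩
    have := LegalStep.delete (G := G) (insert v ∅) g v (by simp) (by simp)
    simpa using this
  | head hstep _ ih =>
    -- Invariant: the value at `v` is at least its number of remaining neighbours. A step lowers the
    -- value by at most one, and only when that number drops too.
    have count : ∀ (S : Set V) (f f' : V → ℤ) (u : V), u ∈ S → v ∉ S →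
        ({x ∈ S | G.Adj x v}.ncard : ℤ) ≤ f v → f v ≤ f' v + (if G.Adj u v then 1 else 0) →
        (({x ∈ S \ {u} | G.Adj x v}).ncard : ℤ) ≤ f' v := by
      intro S f f' u hu hvS h1 h2
      by_cases ha : G.Adj u v
      · have e : {x ∈ S \ {u} | G.Adj x v} = {x ∈ S | G.Adj x v} \ {u} := by
          ext x; simp only [Set.mem_ofPred_eq, Set.mem_sdiff, Set.mem_singleton_iff]; tauto
        have := Set.ncard_sdiff_singleton_add_one (s := {x ∈ S | G.Adj x v}) (a := u) ⟨hu, ha⟩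
        rw [e]
        simp only [ha, if_true] at h2
        omega
      · have : {x ∈ S \ {u} | G.Adj x v}.ncard ≤ {x ∈ S | G.Adj x v}.ncard :=
          Set.ncard_le_ncard (fun x hx => ⟨hx.1.1, hx.2⟩)
        simp only [ha, if_false] at h2
        omega
    cases hstep with
    | delete S f u hu hnn =>
      simp only at hv hf ih
      have hvu : v ≠ u := fun e => hv (e ▸ hu)
      have hc := count S f (deleteFun G f u) u hu hv hf (by unfold deleteFun; split_ifs <;> simp)
      obtain ⟨g', hg'⟩ := ih (fun h => hv h.1) hc
      have e : insert v S \ {u} = insert v (S \ {u}) := Set.insert_sdiff_singleton_comm hvu S |>.symm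
      refine ⟨g', Relation.ReflTransGen.head (LegalStep.delete _ f u (Or.inr hu) ?_) (e ▸ hg')⟩
      rw [e]
      rintro x (rfl | hx)
      · exact le_trans (by positivity) hc
      · exact hnn x hx
    | delSave S f u w hu hw huw hlt hnn =>
      simp only at hv hf ih
      have hvu : v ≠ u := fun e => hv (e ▸ hu)
      have hc := count S f (delSaveFun G f u w) u hu hv hf (by
        unfold delSaveFun
        by_cases ha : G.Adj u v
        · simp only [ha, true_and, if_true]; split_ifs <;> omega
        · simp [ha])
      obtain ⟨g', hg'⟩ := ih (fun h => hv h.1) hc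
      have e : insert v S \ {u} = insert v (S \ {u}) := Set.insert_sdiff_singleton_comm hvu S |>.symm
      refine ⟨g', Relation.ReflTransGen.head
        (LegalStep.delSave _ f u w (Or.inr hu) (Or.inr hw) huw hlt ?_) (e ▸ hg')⟩
      rw [e]
      rintro x (rfl | hx)
      · exact le_trans (by positivity) hc
      · exact hnn x hx

/-- It suffices to remove the induced subgraphs whose minimum degree exceeds the budget. -/
theorem removal_of_core [Finite V] (G : SimpleGraph V) (D : ℕ)
    (hcore : ∀ S : Finset V, (∀ v ∈ S, D < #{x ∈ S | G.Adj x v}) →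
      ∃ g : V → ℤ, Relation.ReflTransGen (LegalStep G) ((S : Set V), fun _ => (D : ℤ)) (∅, g))
    (S : Finset V) :
    ∃ g : V → ℤ, Relation.ReflTransGen (LegalStep G) ((S : Set V), fun _ => (D : ℤ)) (∅, g) := by
  induction S using Finset.strongInduction with
  | H S ih =>
    by_cases h : ∀ v ∈ S, D < #{x ∈ S | G.Adj x v}
    · exact hcore S h
    push Not at h
    obtain ⟨v, hv, hdeg⟩ := h
    obtain ⟨g, hg⟩ := ih (S.erase v) (erase_ssubset hv)
    have := removal_insert G v _ g hg (by simp) (by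
      simp only
      have e : {x ∈ ((S.erase v : Finset V) : Set V) | G.Adj x v} =
          (({x ∈ S.erase v | G.Adj x v} : Finset V) : Set V) := by ext; simp [and_comm]
      rw [e, Set.ncard_coe_finset]
      exact_mod_cast (card_le_card (filter_subset_filter _ (erase_subset v S))).trans hdeg)
    simpa only [coe_erase, Set.insert_sdiff_singleton, Set.insert_eq_of_mem (mem_coe.mpr hv)]
      using this

end Removal

/-! ### Uniform product spaces: independence, Chernoff bounds, local lemma. -/

section Product

open scoped BigOperators

variable {V α ι : Type*}

theorem dependsOn_prod {g : ι → (V → α) → ℝ} {D : ι → Finset V} {I : Finset ι}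
    (hg : ∀ i ∈ I, DependsOn (g i) (D i)) :
    DependsOn (fun ω => ∏ i ∈ I, g i ω) (I.biUnion D : Finset V) := fun _ _ h =>
  prod_congr rfl fun i hi => hg i hi fun v hv => h v (by
    rw [mem_coe, mem_biUnion]; exact ⟨i, hi, mem_coe.mp hv⟩)

theorem dependsOn_ite {P : (V → α) → Prop} {S : Set V} (hP : DependsOn P S) (a b : ℝ) :
    DependsOn (fun ω => if P ω then a else b) S := fun _ _ h => by
  simp only [hP h]

theorem one_sub_sum_le_prod_one_sub {J : Finset ι} {a : ι → ℝ} (h0 : ∀ j ∈ J, 0 ≤ a j)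
    (h1 : ∀ j ∈ J, a j ≤ 1) : 1 - ∑ j ∈ J, a j ≤ ∏ j ∈ J, (1 - a j) := by
  induction J using Finset.induction_on with
  | empty => simp
  | insert i J hi ih =>
    have hJ0 : ∀ j ∈ J, 0 ≤ a j := fun j hj => h0 j (mem_insert_of_mem hj)
    have hJ1 : ∀ j ∈ J, a j ≤ 1 := fun j hj => h1 j (mem_insert_of_mem hj)
    have := ih hJ0 hJ1
    have := sum_nonneg hJ0
    have := h0 i (mem_insert_self i J)
    have := h1 i (mem_insert_self i J)
    rw [sum_insert hi, prod_insert hi]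
    nlinarith

variable [Fintype V] [Fintype α]

/-- The probability of the event `P` under the uniform measure on `V → α`. -/
noncomputable def pr (P : (V → α) → Prop) : ℝ := 𝔼 ω, if P ω then (1 : ℝ) else 0

theorem pr_mono {P Q : (V → α) → Prop} (h : ∀ ω, P ω → Q ω) : pr P ≤ pr Q := by
  refine expect_le_expect fun ω _ => ?_
  by_cases hP : P ω
  · simp [hP, h ω hP]
  · simp only [hP, if_false]; split_ifs <;> norm_num

theorem pr_or_le (P Q : (V → α) → Prop) : pr (fun ω => P ω ∨ Q ω) ≤ pr P + pr Q := by
  unfold pr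
  rw [← expect_add_distrib]
  refine expect_le_expect fun ω _ => ?_
  by_cases hP : P ω <;> by_cases hQ : Q ω <;> simp [hP, hQ]

/-- Markov's inequality in the form used for exponential moments. -/
theorem pr_le_of_one_le {P : (V → α) → Prop} {F : (V → α) → ℝ} (h0 : ∀ ω, 0 ≤ F ω)
    (h1 : ∀ ω, P ω → 1 ≤ F ω) : pr P ≤ 𝔼 ω, F ω := by
  refine expect_le_expect fun ω _ => ?_
  split_ifs with h
  · exact h1 ω h
  · exact h0 ω

variable [Nonempty α]

/-- Resampling the coordinates outside `S` does not change expectations. -/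
theorem expect_piecewise (S : Finset V) (F : (V → α) → ℝ) :
    𝔼 ω, F ω = 𝔼 ω : V → α, 𝔼 ω' : V → α, F (S.piecewise ω ω') := by
  have h1 : 𝔼 ω : V → α, 𝔼 ω' : V → α, F (S.piecewise ω ω') =
      𝔼 x : (V → α) × (V → α), F (S.piecewise x.1 x.2) :=
    (expect_product univ univ fun x : (V → α) × (V → α) => F (S.piecewise x.1 x.2)).symm
  have h2 : 𝔼 x : (V → α) × (V → α), F x.1 = 𝔼 ω, F ω := by
    rw [← univ_product_univ, expect_product]
    simp
  rw [h1, ← h2]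
  symm
  -- Exchanging the coordinates outside `S` between two samples is an involution, hence preserves
  -- the uniform measure.
  let φ : (V → α) × (V → α) → (V → α) × (V → α) :=
    fun x => (S.piecewise x.1 x.2, S.piecewise x.2 x.1)
  have hφ : Function.Involutive φ := by
    rintro ⟨a, b⟩
    simp only [φ, Prod.mk.injEq]
    constructor <;> funext v <;> by_cases hv : v ∈ S <;> simp [hv]
  exact Fintype.expect_bijective φ hφ.bijective _ _ fun x => rfl

/-- After resampling outside `S`, `F` sees only the first sample and `H` only the second, so the
double average factors. -/
theorem expect_mul_of_dependsOn {F H : (V → α) → ℝ} {S T : Finset V} (hF : DependsOn F S)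
    (hH : DependsOn H T) (hST : Disjoint S T) :
    𝔼 ω, F ω * H ω = (𝔼 ω, F ω) * 𝔼 ω, H ω := by
  rw [expect_piecewise S, expect_mul_expect]
  refine expect_congr rfl fun ω _ => expect_congr rfl fun ω' _ => ?_
  congr 1
  · exact hF fun v hv => by simp [mem_coe.mp hv]
  · exact hH fun v hv => by simp [disjoint_right.mp hST (mem_coe.mp hv)]

theorem expect_prod_of_dependsOn {g : ι → (V → α) → ℝ} {D : ι → Finset V} {I : Finset ι}
    (hg : ∀ i ∈ I, DependsOn (g i) (D i))
    (hD : (I : Set ι).PairwiseDisjoint D) :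
    𝔼 ω, ∏ i ∈ I, g i ω = ∏ i ∈ I, 𝔼 ω, g i ω := by
  induction I using Finset.induction_on with
  | empty => simp
  | insert i I hi ih =>
    simp only [prod_insert hi]
    rw [← ih (fun j hj => hg j (mem_insert_of_mem hj))
      (hD.subset (by simp))]
    refine expect_mul_of_dependsOn (hg i (mem_insert_self i I))
      (dependsOn_prod fun j hj => hg j (mem_insert_of_mem hj)) ?_
    rw [disjoint_biUnion_right]
    intro j hj
    exact hD (by simp) (by simp [hj]) (by rintro rfl; exact hi hj)

theorem pr_and_of_dependsOn {P Q : (V → α) → Prop} {S T : Finset V} (hP : DependsOn P S)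
    (hQ : DependsOn Q T) (hST : Disjoint S T) : pr (fun ω => P ω ∧ Q ω) = pr P * pr Q := by
  unfold pr
  rw [← expect_mul_of_dependsOn (dependsOn_ite hP 1 0) (dependsOn_ite hQ 1 0) hST]
  refine expect_congr rfl fun ω _ => ?_
  by_cases h1 : P ω <;> by_cases h2 : Q ω <;> simp [h1, h2]

theorem expect_ite_half (P : (V → α) → Prop) :
    𝔼 ω, (if P ω then (1 / 2 : ℝ) else 1) = 1 - pr P / 2 := by
  have : ∀ ω, (if P ω then (1 / 2 : ℝ) else 1) = 1 - (1 / 2) * (if P ω then (1 : ℝ) else 0) := by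
    intro ω; split_ifs <;> norm_num
  simp only [this]
  rw [expect_sub_distrib, ← mul_expect, Fintype.expect_const, pr]
  ring

theorem expect_ite_two (P : (V → α) → Prop) :
    𝔼 ω, (if P ω then (2 : ℝ) else 1) = 1 + pr P := by
  have : ∀ ω, (if P ω then (2 : ℝ) else 1) = 1 + (if P ω then (1 : ℝ) else 0) := by
    intro ω; split_ifs <;> norm_num
  simp only [this]
  rw [expect_add_distrib, Fintype.expect_const, pr]

/-- Chernoff's bound for the lower tail of a number of independent events. -/
theorem pr_card_filter_lt_le {A : ι → (V → α) → Prop} {D : ι → Finset V} {I : Finset ι}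
    (hA : ∀ i ∈ I, DependsOn (A i) (D i)) (hD : (I : Set ι).PairwiseDisjoint D)
    {q m : ℝ} (hq : ∀ i ∈ I, q ≤ pr (A i)) (hm0 : 0 ≤ m) (hm : m ≤ q * #I / 4) :
    pr (fun ω => (#{i ∈ I | A i ω} : ℝ) < m) ≤ Real.exp (-(q * #I / 4)) := by
  have hlog : Real.log 2 < 0.6931471808 := Real.log_two_lt_d9
  have hlog0 : 0 < Real.log 2 := Real.log_pos (by norm_num)
  -- Markov's inequality for `2 ^ (m - count)`; each event contributes a factor `1 - pr (A i) / 2 ≤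
  -- exp (-q / 2)`.
  have key : pr (fun ω => (#{i ∈ I | A i ω} : ℝ) < m) ≤
      𝔼 ω, Real.exp (Real.log 2 * m) * ∏ i ∈ I, (if A i ω then (1 / 2 : ℝ) else 1) := by
    refine pr_le_of_one_le (fun ω => ?_) fun ω h => ?_
    · refine mul_nonneg (Real.exp_pos _).le (prod_nonneg fun i _ => ?_)
      split_ifs <;> norm_num
    · rw [prod_ite, prod_const, prod_const_one, mul_one]
      have : (1 / 2 : ℝ) ^ #{i ∈ I | A i ω} = Real.exp (-(Real.log 2 * #{i ∈ I | A i ω})) := by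
        rw [mul_comm, ← mul_neg, Real.exp_nat_mul, Real.exp_neg, Real.exp_log (by norm_num)]
        norm_num
      rw [this, ← Real.exp_add]
      apply Real.one_le_exp
      nlinarith
  refine key.trans ?_
  rw [← mul_expect, expect_prod_of_dependsOn (fun i hi => dependsOn_ite (hA i hi) _ _) hD]
  have hprod : ∏ i ∈ I, 𝔼 ω, (if A i ω then (1 / 2 : ℝ) else 1) ≤ Real.exp (-(q * #I / 2)) := by
    calc ∏ i ∈ I, 𝔼 ω, (if A i ω then (1 / 2 : ℝ) else 1) ≤ ∏ i ∈ I, Real.exp (-(q / 2)) := by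
          refine prod_le_prod (fun i _ => ?_) fun i hi => ?_
          · exact expect_nonneg fun ω _ => by split_ifs <;> norm_num
          · rw [expect_ite_half]
            have := Real.add_one_le_exp (-(q / 2))
            linarith [hq i hi]
      _ = Real.exp (-(q * #I / 2)) := by
          rw [prod_const, ← Real.exp_nat_mul]; ring_nf
  calc _ ≤ Real.exp (Real.log 2 * m) * Real.exp (-(q * #I / 2)) :=
        mul_le_mul_of_nonneg_left hprod (Real.exp_pos _).le
    _ ≤ _ := by
        rw [← Real.exp_add]
        apply Real.exp_le_exp.mpr
        nlinarith

/-- Chernoff's bound for the upper tail of a number of independent events. -/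
theorem pr_lt_card_filter_le {A : ι → (V → α) → Prop} {D : ι → Finset V} {I : Finset ι}
    (hA : ∀ i ∈ I, DependsOn (A i) (D i)) (hD : (I : Set ι).PairwiseDisjoint D)
    {q m : ℝ} (hq : ∀ i ∈ I, pr (A i) ≤ q) (hm : 4 * (q * #I) ≤ m) (hm0 : 0 ≤ m) :
    pr (fun ω => m < (#{i ∈ I | A i ω} : ℝ)) ≤ Real.exp (-(m / 4)) := by
  have hlog : 0.6931471803 < Real.log 2 := Real.log_two_gt_d9
  -- Markov's inequality for `2 ^ (count - m)`; each event contributes a factor `1 + pr (A i) ≤ exp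
  -- q`.
  have key : pr (fun ω => m < (#{i ∈ I | A i ω} : ℝ)) ≤
      𝔼 ω, Real.exp (-(Real.log 2 * m)) * ∏ i ∈ I, (if A i ω then (2 : ℝ) else 1) := by
    refine pr_le_of_one_le (fun ω => ?_) fun ω h => ?_
    · refine mul_nonneg (Real.exp_pos _).le (prod_nonneg fun i _ => ?_)
      split_ifs <;> norm_num
    · rw [prod_ite, prod_const, prod_const_one, mul_one]
      have : (2 : ℝ) ^ #{i ∈ I | A i ω} = Real.exp (Real.log 2 * #{i ∈ I | A i ω}) := by
        rw [mul_comm, Real.exp_nat_mul, Real.exp_log (by norm_num)]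
      rw [this, ← Real.exp_add]
      apply Real.one_le_exp
      nlinarith
  refine key.trans ?_
  rw [← mul_expect, expect_prod_of_dependsOn (fun i hi => dependsOn_ite (hA i hi) _ _) hD]
  have hprod : ∏ i ∈ I, 𝔼 ω, (if A i ω then (2 : ℝ) else 1) ≤ Real.exp (q * #I) := by
    calc ∏ i ∈ I, 𝔼 ω, (if A i ω then (2 : ℝ) else 1) ≤ ∏ i ∈ I, Real.exp q := by
          refine prod_le_prod (fun i _ => ?_) fun i hi => ?_
          · exact expect_nonneg fun ω _ => by split_ifs <;> norm_num
          · rw [expect_ite_two]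
            have := Real.add_one_le_exp q
            linarith [hq i hi]
      _ = Real.exp (q * #I) := by
          rw [prod_const, ← Real.exp_nat_mul]; ring_nf
  calc _ ≤ Real.exp (-(Real.log 2 * m)) * Real.exp (q * #I) :=
        mul_le_mul_of_nonneg_left hprod (Real.exp_pos _).le
    _ ≤ _ := by
        rw [← Real.exp_add]
        apply Real.exp_le_exp.mpr
        nlinarith

/-- The symmetric Lovász local lemma for events on a finite product space. -/
theorem exists_forall_not_of_local [Fintype ι] {A : ι → (V → α) → Prop} {D : ι → Finset V}
    (hA : ∀ i, DependsOn (A i) (D i)) {p : ℝ} {Δ : ℕ} (hp : ∀ i, pr (A i) ≤ p)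
    (hΔ : ∀ i, #{j | ¬ Disjoint (D i) (D j)} ≤ Δ) (hΔ1 : 1 ≤ Δ) (hp0 : 0 ≤ p)
    (h : 4 * p * Δ ≤ 1) :
    ∃ ω, ∀ i, ¬ A i ω := by
  let a : ι → (V → α) → ℝ := fun i ω => if A i ω then 1 else 0
  let avoid : Finset ι → (V → α) → ℝ := fun J ω => ∏ j ∈ J, (1 - a j ω)
  have ha0 : ∀ i ω, 0 ≤ a i ω := fun i ω => by simp only [a]; split_ifs <;> norm_num
  have ha1 : ∀ i ω, 0 ≤ 1 - a i ω := fun i ω => by simp only [a]; split_ifs <;> norm_num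
  have hav0 : ∀ J ω, 0 ≤ avoid J ω := fun J ω => prod_nonneg fun j _ => ha1 j ω
  have hmono : ∀ {J J' : Finset ι}, J ⊆ J' → ∀ ω, avoid J' ω ≤ avoid J ω := fun hJ ω =>
    prod_le_prod_of_subset_of_le_one hJ (fun j _ => ha1 j ω) fun j _ _ => by
      linarith [ha0 j ω]
  have hp4 : p ≤ 1 / 4 := by
    have : (1 : ℝ) ≤ Δ := by exact_mod_cast hΔ1
    nlinarith
  -- The usual bound `2p` on the probability of `A i` given that all of `J` is avoided, with the
  -- denominator cleared. Dropping the at most `Δ` events that share coordinates with `A i` leaves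
  -- independence; by induction they cost at most the proportion `2pΔ ≤ 1/2` of the avoidance
  -- probability.
  have main : ∀ n : ℕ, ∀ J : Finset ι, #J = n → ∀ i,
      𝔼 ω, a i ω * avoid J ω ≤ 2 * p * 𝔼 ω, avoid J ω := by
    intro n
    induction n using Nat.strong_induction_on with
    | _ n ih =>
      intro J hJ i
      set J₁ := {j ∈ J | ¬ Disjoint (D i) (D j)} with hJ₁
      set J₂ := {j ∈ J | Disjoint (D i) (D j)} with hJ₂
      have hsub : J₂ ⊆ J := filter_subset _ _
      have hind : 𝔼 ω, a i ω * avoid J₂ ω ≤ p * 𝔼 ω, avoid J₂ ω := by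
        rw [expect_mul_of_dependsOn (S := D i) (T := J₂.biUnion D) (dependsOn_ite (hA i) 1 0)
          (dependsOn_prod fun j _ ω ω' h => by
            simp only [a]; rw [hA j h]) (by
            rw [disjoint_biUnion_right]
            exact fun j hj => (mem_filter.mp hj).2)]
        exact mul_le_mul_of_nonneg_right (hp i) (expect_nonneg fun ω _ => hav0 _ _)
      have hle : 𝔼 ω, a i ω * avoid J ω ≤ 𝔼 ω, a i ω * avoid J₂ ω :=
        expect_le_expect fun ω _ => mul_le_mul_of_nonneg_left (hmono hsub ω) (ha0 i ω)
      have hW2 : 0 ≤ 𝔼 ω, avoid J₂ ω := expect_nonneg fun ω _ => hav0 _ _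
      suffices hhalf : (𝔼 ω, avoid J₂ ω) ≤ 2 * 𝔼 ω, avoid J ω by nlinarith
      rcases eq_or_ne J₂ J with e | e
      · rw [e] at hW2 ⊢; linarith
      have hcard : #J₂ < n := hJ ▸ card_lt_card (hsub.ssubset_of_ne e)
      have hpt : ∀ ω, avoid J₂ ω - ∑ j ∈ J₁, a j ω * avoid J₂ ω ≤ avoid J ω := by
        intro ω
        have hsplit : avoid J ω = avoid J₂ ω * avoid J₁ ω := by
          simp only [avoid, hJ₁, hJ₂]
          exact (prod_filter_mul_prod_filter_not J _ _).symm
        have hbern : 1 - ∑ j ∈ J₁, a j ω ≤ avoid J₁ ω :=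
          one_sub_sum_le_prod_one_sub (fun j _ => ha0 j ω) fun j _ => by linarith [ha1 j ω]
        rw [hsplit, ← sum_mul]
        nlinarith [hav0 J₂ ω]
      have hexp : (𝔼 ω, avoid J₂ ω) - ∑ j ∈ J₁, 𝔼 ω, a j ω * avoid J₂ ω ≤ 𝔼 ω, avoid J ω := by
        rw [← expect_sum_comm, ← expect_sub_distrib]
        exact expect_le_expect fun ω _ => hpt ω
      have hsum : ∑ j ∈ J₁, 𝔼 ω, a j ω * avoid J₂ ω ≤ Δ * (2 * p * 𝔼 ω, avoid J₂ ω) := by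
        calc _ ≤ ∑ j ∈ J₁, 2 * p * 𝔼 ω, avoid J₂ ω := sum_le_sum fun j _ => ih _ hcard J₂ rfl j
          _ = #J₁ * (2 * p * 𝔼 ω, avoid J₂ ω) := by rw [sum_const, nsmul_eq_mul]
          _ ≤ _ := by
            gcongr
            exact (card_le_card (filter_subset_filter _ (subset_univ J))).trans (hΔ i)
      nlinarith
  have hpos : ∀ J : Finset ι, 0 < 𝔼 ω, avoid J ω := by
    intro J
    induction J using Finset.induction_on with
    | empty => simp [avoid]
    | insert i J hi ih =>
      have e : 𝔼 ω, avoid (insert i J) ω = (𝔼 ω, avoid J ω) - 𝔼 ω, a i ω * avoid J ω := by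
        rw [← expect_sub_distrib]
        refine expect_congr rfl fun ω _ => ?_
        simp only [avoid, prod_insert hi]; ring
      have := main _ J rfl i
      rw [e]
      nlinarith
  by_contra hcon
  push Not at hcon
  have hz : 𝔼 ω, avoid univ ω = 0 := expect_eq_zero fun ω _ => by
    obtain ⟨i, hi⟩ := hcon ω
    exact prod_eq_zero (mem_univ i) (by simp [a, hi])
  exact (hpos univ).ne' hz

end Product

/-! ### Fluctuations of order `√n` with constant probability, by moments. -/

section Anticoncentration

open scoped BigOperators

variable {V α : Type*}

theorem dependsOn_sum_eval (f : α → ℝ) (Y : Finset V) (g : ℝ → ℝ) :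
    DependsOn (fun ω : V → α => g (∑ x ∈ Y, f (ω x))) (Y : Set V) := fun _ _ h => by
  simp only
  congr 1
  exact sum_congr rfl fun x hx => by rw [h x (mem_coe.mpr hx)]

theorem sum_indicator_sub (A : α → Prop) [DecidablePred A] (q : ℝ) (Y : Finset V) (ω : V → α) :
    ∑ x ∈ Y, ((if A (ω x) then (1 : ℝ) else 0) - q) = #{x ∈ Y | A (ω x)} - q * #Y := by
  rw [sum_sub_distrib, sum_boole, sum_const, nsmul_eq_mul, mul_comm]

variable [Fintype V] [Fintype α] [Nonempty α]

theorem expect_eval (x : V) (g : α → ℝ) : 𝔼 ω : V → α, g (ω x) = 𝔼 a, g a := by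
  have h1 : 𝔼 y : (V → α) × α, g (y.1 x) = 𝔼 ω : V → α, g (ω x) := by
    rw [← univ_product_univ, expect_product]; simp
  have h2 : 𝔼 y : (V → α) × α, g y.2 = 𝔼 a, g a := by
    rw [← univ_product_univ, expect_product]; simp
  rw [← h1, ← h2]
  let φ : (V → α) × α → (V → α) × α := fun y => (Function.update y.1 x y.2, y.1 x)
  have hφ : Function.Involutive φ := by
    rintro ⟨ω, a⟩; simp [φ]
  exact Fintype.expect_bijective φ hφ.bijective _ _ fun y => rfl

/-- The first, second and fourth moments of a sum of independent centred variables. -/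
theorem expect_sum_eval_moments {f : α → ℝ} (hf : 𝔼 a, f a = 0) (hf1 : ∀ a, |f a| ≤ 1)
    (Y : Finset V) :
    𝔼 ω : V → α, ∑ x ∈ Y, f (ω x) = 0 ∧
    𝔼 ω : V → α, (∑ x ∈ Y, f (ω x)) ^ 2 = #Y * 𝔼 a, f a ^ 2 ∧
    𝔼 ω : V → α, (∑ x ∈ Y, f (ω x)) ^ 4 ≤ 3 * (#Y : ℝ) ^ 2 := by
  have hs1 : 𝔼 a, f a ^ 2 ≤ 1 := by
    refine (expect_le_expect (g := fun _ => (1 : ℝ)) fun a _ => ?_).trans (by simp)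
    exact (sq_le_one_iff_abs_le_one _).mpr (hf1 a)
  have hs0 : 0 ≤ 𝔼 a, f a ^ 2 := expect_nonneg fun a _ => sq_nonneg _
  have hs4 : 𝔼 a, f a ^ 4 ≤ 1 := by
    refine (expect_le_expect (g := fun _ => (1 : ℝ)) fun a _ => ?_).trans (by simp)
    have := (sq_le_one_iff_abs_le_one _).mpr (hf1 a)
    nlinarith [sq_nonneg (f a)]
  induction Y using Finset.induction_on with
  | empty => simp
  | insert y Y hy ih =>
    obtain ⟨h1, h2, h4⟩ := ih
    -- Mixed moments factor, so every cross term containing a first power vanishes; in the fourth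
    -- moment only the `6 S² f²` term survives.
    have ind : ∀ i j : ℕ, 𝔼 ω : V → α, (∑ x ∈ Y, f (ω x)) ^ i * f (ω y) ^ j =
        (𝔼 ω : V → α, (∑ x ∈ Y, f (ω x)) ^ i) * 𝔼 a, f a ^ j := by
      intro i j
      rw [expect_mul_of_dependsOn (S := Y) (T := {y}) (dependsOn_sum_eval f Y (· ^ i))
        (fun ω ω' h => by rw [h y (by simp)]) (by simpa using hy)]
      rw [expect_eval y fun a => f a ^ j]
    have e1 : 𝔼 ω : V → α, f (ω y) = 0 := by rw [expect_eval y f, hf]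
    have e2 : 𝔼 ω : V → α, f (ω y) ^ 2 = 𝔼 a, f a ^ 2 := expect_eval y fun a => f a ^ 2
    have e4 : 𝔼 ω : V → α, f (ω y) ^ 4 = 𝔼 a, f a ^ 4 := expect_eval y fun a => f a ^ 4
    simp only [sum_insert hy, card_insert_of_notMem hy]
    refine ⟨?_, ?_, ?_⟩
    · rw [expect_add_distrib, e1, h1, add_zero]
    · have : ∀ ω : V → α, (f (ω y) + ∑ x ∈ Y, f (ω x)) ^ 2 = f (ω y) ^ 2 +
          2 * ((∑ x ∈ Y, f (ω x)) ^ 1 * f (ω y) ^ 1) + (∑ x ∈ Y, f (ω x)) ^ 2 := fun ω => by ring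
      simp only [this]
      rw [expect_add_distrib, expect_add_distrib, ← mul_expect, ind, e2, h2]
      simp only [pow_one, hf]
      push_cast; ring
    · have : ∀ ω : V → α, (f (ω y) + ∑ x ∈ Y, f (ω x)) ^ 4 = f (ω y) ^ 4 +
          4 * ((∑ x ∈ Y, f (ω x)) ^ 1 * f (ω y) ^ 3) +
          6 * ((∑ x ∈ Y, f (ω x)) ^ 2 * f (ω y) ^ 2) +
          4 * ((∑ x ∈ Y, f (ω x)) ^ 3 * f (ω y) ^ 1) + (∑ x ∈ Y, f (ω x)) ^ 4 := fun ω => by ring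
      simp only [this]
      rw [expect_add_distrib, expect_add_distrib, expect_add_distrib, expect_add_distrib,
        ← mul_expect, ← mul_expect, ← mul_expect, ind, ind, ind, e4, h2]
      simp only [pow_one, hf, h1]
      have hn : (0 : ℝ) ≤ #Y := Nat.cast_nonneg _
      have hss : (𝔼 a, f a ^ 2) * (𝔼 a, f a ^ 2) ≤ 1 := by nlinarith
      push_cast
      nlinarith [mul_le_mul_of_nonneg_left hss hn]

/-- Averaging this for mean zero, second moment at least `1/8` and fourth moment at most `3` leaves
`1/8 - 1/16 - 1/32 = 1/32` on the left, hence probability at least `1/2048`. The term `7 * x` is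
free on average and cancels `x ^ 2` on `[-7, 0]`; below `-7` the quartic term dominates. -/
theorem quartic_le_indicator (x : ℝ) :
    7 * x + x ^ 2 - x ^ 4 / 48 - 1 / 32 ≤ 64 * (if 1 / 256 ≤ x then (1 : ℝ) else 0) := by
  split_ifs with h
  · nlinarith [sq_nonneg (x ^ 2 - 36), sq_nonneg (x - 6)]
  · push Not at h
    rcases le_or_gt 0 x with h0 | h0
    · nlinarith [pow_nonneg h0 4, mul_nonneg h0 h0]
    · rcases le_or_gt (-7) x with h7 | h7
      · nlinarith [sq_nonneg (x ^ 2)]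
      · have : (49 : ℝ) ≤ x ^ 2 := by nlinarith
        nlinarith [sq_nonneg (x ^ 2)]

/-- A sum of `n` independent centred variables of variance bounded below exceeds its mean by a
multiple of `√n` with probability bounded below. -/
theorem le_pr_sqrt_le_sum {f : α → ℝ} (hf : 𝔼 a, f a = 0) (hf1 : ∀ a, |f a| ≤ 1)
    (hs : 1 / 8 ≤ 𝔼 a, f a ^ 2) {Y : Finset V} (hY : Y.Nonempty) :
    1 / 2048 ≤ pr fun ω : V → α => √(#Y : ℝ) / 256 ≤ ∑ x ∈ Y, f (ω x) := by
  obtain ⟨h1, h2, h4⟩ := expect_sum_eval_moments hf hf1 Y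
  have hn : (0 : ℝ) < #Y := by exact_mod_cast hY.card_pos
  set r := √(#Y : ℝ) with hr
  have hr0 : 0 < r := Real.sqrt_pos.mpr hn
  have hr2 : r ^ 2 = #Y := Real.sq_sqrt hn.le
  have hpt : ∀ ω : V → α, 7 / r * (∑ x ∈ Y, f (ω x)) + 1 / r ^ 2 * (∑ x ∈ Y, f (ω x)) ^ 2 -
      1 / (48 * r ^ 4) * (∑ x ∈ Y, f (ω x)) ^ 4 - 1 / 32 ≤
      64 * (if r / 256 ≤ ∑ x ∈ Y, f (ω x) then (1 : ℝ) else 0) := by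
    intro ω
    have := quartic_le_indicator ((∑ x ∈ Y, f (ω x)) / r)
    have e : (1 / 256 ≤ (∑ x ∈ Y, f (ω x)) / r) = (r / 256 ≤ ∑ x ∈ Y, f (ω x)) := by
      rw [le_div_iff₀ hr0]; congr 1; ring
    simp only [e] at this
    refine le_trans (le_of_eq ?_) this
    field_simp
  have hE := expect_le_expect fun ω (_ : ω ∈ (univ : Finset (V → α))) => hpt ω
  rw [expect_sub_distrib, expect_sub_distrib, expect_add_distrib, ← mul_expect, ← mul_expect,
    ← mul_expect, ← mul_expect, h1, h2, Fintype.expect_const] at hE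
  change _ ≤ 64 * pr _ at hE
  have a2 : 1 / r ^ 2 * (#Y * 𝔼 a, f a ^ 2) = 𝔼 a, f a ^ 2 := by
    rw [hr2]; field_simp
  have a4 : 1 / (48 * r ^ 4) * 𝔼 ω : V → α, (∑ x ∈ Y, f (ω x)) ^ 4 ≤ 1 / 16 := by
    have : r ^ 4 = (#Y : ℝ) ^ 2 := by rw [← hr2]; ring
    rw [this, one_div_mul_eq_div, div_le_iff₀ (by positivity)]
    linarith
  rw [a2] at hE
  linarith

theorem expect_indicator_sub {A : α → Prop} [DecidablePred A] {q : ℝ}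
    (hA : 𝔼 a, (if A a then (1 : ℝ) else 0) = q) :
    𝔼 a, ((if A a then (1 : ℝ) else 0) - q) = 0 ∧
    𝔼 a, ((if A a then (1 : ℝ) else 0) - q) ^ 2 = q - q ^ 2 := by
  constructor
  · rw [expect_sub_distrib, hA, Fintype.expect_const, sub_self]
  · have : ∀ a, ((if A a then (1 : ℝ) else 0) - q) ^ 2 =
        (1 - 2 * q) * (if A a then (1 : ℝ) else 0) + q ^ 2 := by
      intro a; split_ifs <;> ring
    simp only [this]
    rw [expect_add_distrib, ← mul_expect, hA, Fintype.expect_const]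
    ring

/-- The range of `q` keeps the variance `q - q ^ 2` at least `4/25 > 1/8`. -/
theorem le_pr_card_filter_ge {A : α → Prop} [DecidablePred A] {q : ℝ}
    (hA : 𝔼 a, (if A a then (1 : ℝ) else 0) = q) (hq : 1 / 5 ≤ q) (hq' : q ≤ 4 / 5)
    {Y : Finset V} (hY : Y.Nonempty) :
    1 / 2048 ≤ pr fun ω : V → α => q * #Y + √(#Y : ℝ) / 256 ≤ #{x ∈ Y | A (ω x)} := by
  obtain ⟨h1, h2⟩ := expect_indicator_sub hA
  refine (le_pr_sqrt_le_sum h1 (fun a => ?_) ?_ hY).trans (pr_mono fun ω h => ?_)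
  · rw [abs_le]; split_ifs <;> constructor <;> linarith
  · rw [h2]; nlinarith
  · rw [sum_indicator_sub] at h; linarith

theorem le_pr_card_filter_le {A : α → Prop} [DecidablePred A] {q : ℝ}
    (hA : 𝔼 a, (if A a then (1 : ℝ) else 0) = q) (hq : 1 / 5 ≤ q) (hq' : q ≤ 4 / 5)
    {Y : Finset V} (hY : Y.Nonempty) :
    1 / 2048 ≤ pr fun ω : V → α => #{x ∈ Y | A (ω x)} ≤ q * #Y - √(#Y : ℝ) / 256 := by
  obtain ⟨h1, h2⟩ := expect_indicator_sub hA
  refine (le_pr_sqrt_le_sum (f := fun a => -((if A a then (1 : ℝ) else 0) - q))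
    (by rw [expect_neg_distrib, h1, neg_zero]) (fun a => ?_) ?_ hY).trans
    (pr_mono fun ω h => ?_)
  · rw [abs_le]; split_ifs <;> constructor <;> linarith
  · simp only [neg_sq]; rw [h2]; nlinarith
  · rw [sum_neg_distrib, sum_indicator_sub] at h; linarith

end Anticoncentration

/-! ### Random times: neighbourhoods that run ahead of their mean. -/

section Times

open scoped BigOperators

variable {V : Type*} {d N : ℕ}

theorem expect_comp_fst [NeZero N] (g : Fin d → ℝ) :
    𝔼 a : Fin d × Fin N, g a.1 = 𝔼 i, g i := by
  rw [← univ_product_univ, expect_product]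
  simp

theorem expect_comp_snd [NeZero d] (g : Fin N → ℝ) :
    𝔼 a : Fin d × Fin N, g a.2 = 𝔼 i, g i := by
  rw [← univ_product_univ, expect_product]
  simp

theorem expect_fst_lt [NeZero d] [NeZero N] {t : ℕ} (ht : t ≤ d) :
    𝔼 a : Fin d × Fin N, (if (a.1 : ℕ) < t then (1 : ℝ) else 0) = t / d := by
  refine (expect_comp_fst fun i : Fin d => if (i : ℕ) < t then (1 : ℝ) else 0).trans ?_
  rw [Fintype.expect_eq_sum_div_card, Fintype.card_fin, sum_boole, Fin.card_filter_val_lt,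
    min_eq_right ht]

theorem expect_snd_eq_zero [NeZero d] [NeZero N] :
    𝔼 a : Fin d × Fin N, (if a.2 = 0 then (1 : ℝ) else 0) = 1 / N := by
  refine (expect_comp_snd fun i : Fin N => if i = 0 then (1 : ℝ) else 0).trans ?_
  rw [Fintype.expect_eq_sum_div_card, Fintype.card_fin, sum_boole]
  simp [filter_eq']

/-- The times in the middle half of `{0, …, d - 1}`. -/
def IsMid (d t : ℕ) : Prop := d ≤ 4 * t ∧ 4 * t ≤ 3 * d

theorem le_expect_isMid [NeZero d] [NeZero N] (hd : 4 ≤ d) :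
    1 / 4 ≤ 𝔼 a : Fin d × Fin N, (if IsMid d a.1 then (1 : ℝ) else 0) := by
  refine le_of_le_of_eq ?_ (expect_comp_fst fun i : Fin d => if IsMid d i then (1 : ℝ) else 0).symm
  rw [Fintype.expect_eq_sum_div_card, Fintype.card_fin, sum_boole,
    le_div_iff₀ (by exact_mod_cast (by omega : 0 < d))]
  have hcard : #(Icc (d / 4 + 1) (3 * d / 4)) ≤ #{i : Fin d | IsMid d i} := by
    refine card_le_card_of_surjOn (fun i : Fin d => (i : ℕ)) fun t ht => ?_
    have ht' := mem_Icc.mp (mem_coe.mp ht)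
    refine ⟨⟨t, by omega⟩, ?_, rfl⟩
    rw [mem_coe, mem_filter, IsMid]
    exact ⟨mem_univ _, by simp only; omega, by simp only; omega⟩
  rw [Nat.card_Icc] at hcard
  have : d ≤ 4 * #{i : Fin d | IsMid d i} := by omega
  have : (d : ℝ) ≤ 4 * #{i : Fin d | IsMid d i} := by exact_mod_cast this
  linarith

/-- At the time of `u`, the number of removed vertices of `Y` exceeds its mean by `δ`. -/
def Ahead (δ : ℝ) (Y : Finset V) (ω : V → Fin d × Fin N) (u : V) : Prop :=
  IsMid d (ω u).1 ∧ ((ω u).1 : ℕ) + δ ≤ #{x ∈ Y | ((ω x).1 : ℕ) < (ω u).1}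

/-- `Y` is ahead of its mean at the times of at least `m` of its elements. -/
def Good (δ m : ℝ) (Y : Finset V) (ω : V → Fin d × Fin N) : Prop :=
  m ≤ #{u ∈ Y | Ahead δ Y ω u}

theorem Ahead.mono {δ : ℝ} {Y Y' : Finset V} (h : Y ⊆ Y') {ω : V → Fin d × Fin N} {u : V}
    (hu : Ahead δ Y ω u) : Ahead δ Y' ω u :=
  ⟨hu.1, hu.2.trans (by exact_mod_cast card_le_card (filter_subset_filter _ h))⟩

theorem Good.mono {δ m : ℝ} {Y Y' : Finset V} (h : Y ⊆ Y') {ω : V → Fin d × Fin N}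
    (hY : Good δ m Y ω) : Good δ m Y' ω := by
  refine le_trans hY ?_
  have : ({u ∈ Y | Ahead δ Y ω u} : Finset V) ⊆ {u ∈ Y' | Ahead δ Y' ω u} := fun u hu => by
    rw [mem_filter] at hu ⊢
    exact ⟨h hu.1, hu.2.mono h⟩
  exact_mod_cast card_le_card this

theorem dependsOn_good (δ m : ℝ) (Y : Finset V) :
    DependsOn (Good (d := d) (N := N) δ m Y) (Y : Set V) := by
  intro ω ω' h
  have key : ∀ u ∈ Y, Ahead δ Y ω u ↔ Ahead δ Y ω' u := by
    intro u hu
    have e : ({x ∈ Y | ((ω x).1 : ℕ) < (ω u).1} : Finset V) =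
        {x ∈ Y | ((ω' x).1 : ℕ) < (ω' u).1} :=
      filter_congr fun x hx => by rw [h x (mem_coe.mpr hx), h u (mem_coe.mpr hu)]
    unfold Ahead
    rw [e, h u (mem_coe.mpr hu)]
  unfold Good
  rw [filter_congr key]

variable [Fintype V]

/-- Condition on the time of `u`, which is in the middle half with probability at least `1/4`; the
other elements of `Y` then fluctuate upwards with probability at least `1/2048`. The gain `(3/4) √d
/ 2 ^ 8` outweighs the loss `√d / 2 ^ 11` due to `#Y` being below `d`, and leaves `√d / 2 ^ 9`. -/
theorem le_pr_ahead [NeZero d] [NeZero N] (hd : 2 ^ 30 ≤ d) {Y : Finset V}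
    (hY : (d : ℝ) - √d / 2 ^ 12 ≤ #Y) {u : V} (hu : u ∈ Y) :
    1 / 8192 ≤ pr fun ω : V → Fin d × Fin N => Ahead (√d / 2 ^ 9) Y ω u := by
  have hdR : (2 : ℝ) ^ 30 ≤ d := by exact_mod_cast hd
  have hd0 : (0 : ℝ) < d := by linarith
  have hsq : √(d : ℝ) ^ 2 = d := Real.sq_sqrt hd0.le
  have hs0 : (2 : ℝ) ^ 15 ≤ √d := by
    rw [show (2 : ℝ) ^ 15 = √(2 ^ 30) by
      rw [show (2 : ℝ) ^ 30 = (2 ^ 15) ^ 2 by norm_num, Real.sqrt_sq (by norm_num)]]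
    exact Real.sqrt_le_sqrt hdR
  have hYu : (#(Y.erase u) : ℝ) = #Y - 1 := by
    rw [card_erase_of_mem hu, Nat.cast_sub (card_pos.mpr ⟨u, hu⟩), Nat.cast_one]
  have hYu2 : (d : ℝ) - √d / 2 ^ 11 ≤ #(Y.erase u) := by rw [hYu]; linarith
  have hYne : (Y.erase u).Nonempty := by
    rw [← card_pos]
    have : (0 : ℝ) < #(Y.erase u) := by nlinarith
    exact_mod_cast this
  have hroot : √d * (3 / 4) ≤ √(#(Y.erase u) : ℝ) := by
    apply Real.le_sqrt_of_sq_le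
    rw [mul_pow, hsq]
    nlinarith
  have key : ∀ ω ω' : V → Fin d × Fin N, IsMid d (ω u).1 →
      (((ω u).1 : ℕ) / d : ℝ) * #(Y.erase u) + √(#(Y.erase u) : ℝ) / 256 ≤
        #{x ∈ Y.erase u | ((ω' x).1 : ℕ) < (ω u).1} →
      Ahead (√d / 2 ^ 9) Y (({u} : Finset V).piecewise ω ω') u := by
    intro ω ω' hmid h
    refine ⟨by simpa using hmid, ?_⟩
    have hc : (#{x ∈ Y.erase u | ((ω' x).1 : ℕ) < (ω u).1} : ℝ) ≤
        #{x ∈ Y | (((({u} : Finset V).piecewise ω ω') x).1 : ℕ) <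
          ((({u} : Finset V).piecewise ω ω') u).1} := by
      refine Nat.cast_le.mpr (card_le_card fun x hx => ?_)
      simp only [mem_filter, mem_erase] at hx ⊢
      exact ⟨hx.1.2, by simpa [hx.1.1] using hx.2⟩
    refine le_trans ?_ (h.trans hc)
    have e : (({u} : Finset V).piecewise ω ω') u = ω u := by simp
    rw [e]
    set t : ℝ := (((ω u).1 : ℕ) : ℝ) with ht
    have ht0 : 0 ≤ t := Nat.cast_nonneg _
    have htd : t ≤ d := by rw [ht]; exact_mod_cast (ω u).1.isLt.le
    have hq1 : t / d ≤ 1 := by rw [div_le_one hd0]; exact htd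
    have hq0 : 0 ≤ t / d := by positivity
    have hqd : t / d * d = t := by field_simp
    have : t - √d / 2 ^ 11 ≤ t / d * #(Y.erase u) := by
      have := mul_le_mul_of_nonneg_left hYu2 hq0
      have : t / d * (√d / 2 ^ 11) ≤ 1 * (√d / 2 ^ 11) :=
        mul_le_mul_of_nonneg_right hq1 (by positivity)
      nlinarith
    linarith
  have hmidq : ∀ ω : V → Fin d × Fin N, IsMid d (ω u).1 →
      1 / 2048 ≤ 𝔼 ω' : V → Fin d × Fin N,
        if Ahead (√d / 2 ^ 9) Y (({u} : Finset V).piecewise ω ω') u then (1 : ℝ) else 0 := by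
    intro ω hmid
    have hq : (d : ℝ) ≤ 4 * ((ω u).1 : ℕ) := by exact_mod_cast hmid.1
    have hq' : 4 * (((ω u).1 : ℕ) : ℝ) ≤ 3 * d := by exact_mod_cast hmid.2
    exact (le_pr_card_filter_ge (q := ((ω u).1 : ℕ) / d) (A := fun a : Fin d × Fin N => (a.1 : ℕ) < (ω u).1)
      (expect_fst_lt (ω u).1.isLt.le) (by rw [le_div_iff₀ hd0]; linarith)
      (by rw [div_le_iff₀ hd0]; linarith) hYne).trans (pr_mono fun ω' h => key ω ω' hmid h)
  have h1 : 𝔼 ω : V → Fin d × Fin N, 1 / 2048 * (if IsMid d (ω u).1 then (1 : ℝ) else 0) ≤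
      pr fun ω : V → Fin d × Fin N => Ahead (√d / 2 ^ 9) Y ω u := by
    unfold pr
    rw [expect_piecewise {u} fun ω : V → Fin d × Fin N =>
      if Ahead (√d / 2 ^ 9) Y ω u then (1 : ℝ) else 0]
    refine expect_le_expect fun ω _ => ?_
    by_cases hmid : IsMid d (ω u).1
    · rw [if_pos hmid, mul_one]
      exact hmidq ω hmid
    · rw [if_neg hmid, mul_zero]
      exact expect_nonneg fun _ _ => by split_ifs <;> norm_num
  rw [← mul_expect, expect_eval u fun a : Fin d × Fin N =>
    if IsMid d a.1 then (1 : ℝ) else 0] at h1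
  have := le_expect_isMid (d := d) (N := N) (by omega)
  linarith

/-- Reverse Markov: the number of ahead elements is at most `d` and has mean at least `d / 2 ^ 14`,
so it reaches half of this with probability at least `1 / 2 ^ 15`. -/
theorem le_pr_good [NeZero d] [NeZero N] (hd : 2 ^ 30 ≤ d) {Y : Finset V} (hYd : #Y ≤ d)
    (hY : (d : ℝ) - √d / 2 ^ 12 ≤ #Y) :
    1 / 2 ^ 15 ≤ pr (Good (d := d) (N := N) (√d / 2 ^ 9) (d / 2 ^ 15) Y) := by
  have hdR : (2 : ℝ) ^ 30 ≤ d := by exact_mod_cast hd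
  have hd0 : (0 : ℝ) < d := by linarith
  have hYR : (#Y : ℝ) ≤ d := by exact_mod_cast hYd
  have hsd : √(d : ℝ) ≤ d := by
    rw [Real.sqrt_le_left hd0.le]; nlinarith
  have hcount : ∑ u ∈ Y, pr (fun ω : V → Fin d × Fin N => Ahead (√d / 2 ^ 9) Y ω u) =
      𝔼 ω : V → Fin d × Fin N, (#{u ∈ Y | Ahead (√d / 2 ^ 9) Y ω u} : ℝ) := by
    unfold pr
    rw [← expect_sum_comm]
    simp only [sum_boole]
  have hlow : (#Y : ℝ) * (1 / 8192) ≤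
      ∑ u ∈ Y, pr (fun ω : V → Fin d × Fin N => Ahead (√d / 2 ^ 9) Y ω u) := by
    rw [← nsmul_eq_mul]
    exact card_nsmul_le_sum _ _ _ fun u hu => le_pr_ahead hd hY hu
  have hup : 𝔼 ω : V → Fin d × Fin N, (#{u ∈ Y | Ahead (√d / 2 ^ 9) Y ω u} : ℝ) ≤
      𝔼 ω : V → Fin d × Fin N, (d / 2 ^ 15 +
        d * (if Good (√d / 2 ^ 9) (d / 2 ^ 15) Y ω then (1 : ℝ) else 0)) := by
    refine expect_le_expect fun ω _ => ?_
    split_ifs with h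
    · have : (#{u ∈ Y | Ahead (√d / 2 ^ 9) Y ω u} : ℝ) ≤ #Y :=
        Nat.cast_le.mpr (card_filter_le _ _)
      have : (0 : ℝ) < d / 2 ^ 15 := by positivity
      linarith
    · unfold Good at h
      linarith
  rw [expect_add_distrib, ← mul_expect, Fintype.expect_const] at hup
  change _ ≤ _ + d * pr _ at hup
  have : (d : ℝ) * (1 / 2 ^ 15) ≤ d * pr (Good (d := d) (N := N) (√d / 2 ^ 9) (d / 2 ^ 15) Y) := by
    linarith
  exact le_of_mul_le_mul_left this hd0

end Times

/-! ### Tail bounds at a vertex and the choice of times and postponed set. -/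

section RandomOrder

open scoped BigOperators

variable {V : Type*} {d N : ℕ}

/-- The neighbourhoods of a graph on `S` without triangles and four-cycles, all of whose degrees
are close to `d`. -/
structure IsNearRegular (nb : V → Finset V) (S : Finset V) (d : ℕ) : Prop where
  symm : ∀ {u v}, u ∈ nb v → v ∈ nb u
  irrefl : ∀ v, v ∉ nb v
  triangleFree : ∀ {u w}, u ∈ nb w → Disjoint (nb u) (nb w)
  squareFree : ∀ {u w x y}, u ≠ w → x ∈ nb u → x ∈ nb w → y ∈ nb u → y ∈ nb w → x = y
  subset : ∀ v, nb v ⊆ S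
  card_le : ∀ v, #(nb v) ≤ d
  le_card : ∀ v ∈ S, (d : ℝ) - √d / 2 ^ 13 ≤ #(nb v)

/-- At the time of `u`, the vertex `w` has lost many more neighbours than expected, and `u` has not,
so that the removal of `u` can save `w`. -/
def Useful (nb : V → Finset V) (ω : V → Fin d × Fin N) (w u : V) : Prop :=
  Ahead (√d / 2 ^ 9) (nb w) ω u ∧ #{x ∈ nb u | ((ω x).1 : ℕ) ≤ (ω u).1} ≤ ((ω u).1 : ℕ)

variable {nb : V → Finset V} {S : Finset V}

theorem two_pow_le_sqrt (hd : 2 ^ 30 ≤ d) : (2 : ℝ) ^ 15 ≤ √d := by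
  apply Real.le_sqrt_of_sq_le
  have : (2 : ℝ) ^ 30 ≤ d := by exact_mod_cast hd
  linarith

theorem IsNearRegular.le_card_erase (h : IsNearRegular nb S d) (hd : 2 ^ 30 ≤ d) {v : V}
    (hv : v ∈ S) (x : V) : (d : ℝ) - √d / 2 ^ 12 ≤ #((nb v).erase x) := by
  have h1 := h.le_card v hv
  have h2 := two_pow_le_sqrt hd
  have h3 : (#(nb v) : ℝ) - 1 ≤ #((nb v).erase x) := by
    have := pred_card_le_card_erase (s := nb v) (a := x)
    have : #(nb v) ≤ #((nb v).erase x) + 1 := by omega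
    have : (#(nb v) : ℝ) ≤ #((nb v).erase x) + 1 := by exact_mod_cast this
    linarith
  linarith

theorem IsNearRegular.disjoint_erase (h : IsNearRegular nb S d) {u w v : V} (hu : u ∈ nb v)
    (hw : w ∈ nb v) (huw : u ≠ w) : Disjoint ((nb u).erase v) ((nb w).erase v) := by
  rw [disjoint_left]
  intro x hx hx'
  rw [mem_erase] at hx hx'
  exact hx.1 (h.squareFree huw hx.2 hx'.2 (h.symm hu) (h.symm hw))

theorem sqrt_le_self_div (hd : 2 ^ 30 ≤ d) : √(d : ℝ) ≤ d / 2 ^ 15 := by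
  have h := two_pow_le_sqrt hd
  have : √(d : ℝ) ^ 2 = d := Real.sq_sqrt (Nat.cast_nonneg _)
  nlinarith

/-- The vertices reached from `v` by walks of length one or two. -/
noncomputable def twoBall (nb : V → Finset V) (v : V) : Finset V := nb v ∪ (nb v).biUnion nb

theorem IsNearRegular.card_twoBall_le (h : IsNearRegular nb S d) (v : V) :
    #(twoBall nb v) ≤ d + d * d :=
  (card_union_le _ _).trans (add_le_add (h.card_le v)
    ((card_biUnion_le_card_mul _ _ d fun w _ => h.card_le w).trans
      (Nat.mul_le_mul_right d (h.card_le v))))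

theorem IsNearRegular.mem_twoBall_symm (h : IsNearRegular nb S d) {u v : V}
    (hu : u ∈ twoBall nb v) : v ∈ twoBall nb u := by
  unfold twoBall at hu ⊢
  rw [mem_union, mem_biUnion] at hu ⊢
  rcases hu with hu | ⟨w, hw, hu⟩
  · exact Or.inl (h.symm hu)
  · exact Or.inr ⟨w, h.symm hu, h.symm hw⟩

variable [Fintype V]

theorem pr_coin_eq [NeZero d] [NeZero N] (v : V) :
    pr (fun ω : V → Fin d × Fin N => (ω v).2 = 0) = 1 / N := by
  rw [← expect_snd_eq_zero (d := d), ← expect_eval v]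
  unfold pr
  refine expect_congr rfl fun ω _ => ?_
  by_cases h : (ω v).2 = 0 <;> simp [h]

/-- The mean is at most `d / N ≤ √d / 2 ^ 13`, a quarter of the threshold. -/
theorem pr_many_coins_le [NeZero d] [NeZero N] (h : IsNearRegular nb S d)
    (hN : 2 ^ 13 * √d ≤ N) (v : V) :
    pr (fun ω : V → Fin d × Fin N => √d / 2 ^ 11 < (#{w ∈ nb v | (ω w).2 = 0} : ℝ)) ≤
      Real.exp (-(√d / 2 ^ 13)) := by
  have hd0 : (0 : ℝ) < d := by exact_mod_cast NeZero.pos d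
  have hs : 0 < √(d : ℝ) := Real.sqrt_pos.mpr hd0
  have hsq : √(d : ℝ) ^ 2 = d := Real.sq_sqrt hd0.le
  have hN0 : (0 : ℝ) < N := by exact_mod_cast NeZero.pos N
  have := pr_lt_card_filter_le (V := V) (I := nb v) (D := fun w => {w}) (q := 1 / N)
    (m := √d / 2 ^ 11) (A := fun w (ω : V → Fin d × Fin N) => (ω w).2 = 0)
    (fun w _ ω ω' h => by simp only [h w (by simp)]) (fun x _ y _ hxy => by simpa using hxy)
    (fun w _ => (pr_coin_eq w).le) (by
      have hc : (#(nb v) : ℝ) ≤ d := by exact_mod_cast h.card_le v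
      rw [one_div_mul_eq_div, ← mul_div_assoc, div_le_iff₀ hN0]
      nlinarith) (by positivity)
  refine le_trans (le_of_eq ?_) (this.trans (Real.exp_le_exp.mpr ?_))
  · congr 1
    funext ω
    congr!
  · linarith

/-- Erasing the common neighbour `v` from each `nb w` makes the events depend on disjoint sets, and
goodness passes back up to `nb w`. The mean is at least `√d / 2 ^ 30`, and Chernoff costs a factor
four. -/
theorem pr_few_reserved_le [NeZero d] [NeZero N] (h : IsNearRegular nb S d)
    (hd : 2 ^ 30 ≤ d) (hN : N ≤ 2 ^ 14 * √d) {v : V} (hv : v ∈ S) :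
    pr (fun ω : V → Fin d × Fin N => (#{w ∈ nb v | (ω w).2 = 0 ∧
      Good (√d / 2 ^ 9) (d / 2 ^ 15) (nb w) ω} : ℝ) < √d / 2 ^ 32) ≤
      Real.exp (-(√d / 2 ^ 32)) := by
  have hd0 : (0 : ℝ) < d := by exact_mod_cast NeZero.pos d
  have hs : 0 < √(d : ℝ) := Real.sqrt_pos.mpr hd0
  have hsq : √(d : ℝ) ^ 2 = d := Real.sq_sqrt hd0.le
  have hN0 : (0 : ℝ) < N := by exact_mod_cast NeZero.pos N
  have hcard : (d : ℝ) / 2 ≤ #(nb v) := by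
    have := h.le_card v hv
    have := sqrt_le_self_div hd
    linarith
  have hq : √d / 2 ^ 32 ≤ 1 / N * (1 / 2 ^ 15) * #(nb v) / 4 := by
    have : 1 / (2 ^ 14 * √(d : ℝ)) ≤ 1 / N := one_div_le_one_div_of_le hN0 hN
    calc √d / 2 ^ 32 = 1 / (2 ^ 14 * √d) * (1 / 2 ^ 15) * (d / 2) / 4 := by
          rw [← hsq]; field_simp; rw [Real.sqrt_sq hs.le]; norm_num
      _ ≤ _ := by gcongr
  have := pr_card_filter_lt_le (V := V) (I := nb v) (D := fun w => insert w ((nb w).erase v))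
    (q := 1 / N * (1 / 2 ^ 15)) (m := √d / 2 ^ 32)
    (A := fun w (ω : V → Fin d × Fin N) => (ω w).2 = 0 ∧
      Good (√d / 2 ^ 9) (d / 2 ^ 15) ((nb w).erase v) ω)
    (fun w _ ω ω' h => by
      simp only [h w (by simp)]
      rw [dependsOn_good _ _ _ fun x hx => h x (by
        rw [mem_coe] at hx ⊢; exact mem_insert_of_mem hx)])
    (fun u hu w hw huw => by
      rw [mem_coe] at hu hw
      have key : ∀ {u w}, u ∈ nb v → w ∈ nb v → u ∉ nb w := fun {u w} hu hw huw =>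
        disjoint_left.mp (h.triangleFree hw) huw hu
      simp only [Function.onFun, disjoint_insert_left, disjoint_insert_right, mem_insert,
        mem_erase]
      exact ⟨by
        rintro (e | e)
        · exact huw e.symm
        · exact key hw hu e.2, fun e => key hu hw e.2, h.disjoint_erase hu hw huw⟩)
    (fun w hw => by
      rw [pr_and_of_dependsOn (S := {w}) (T := (nb w).erase v)
        (fun ω ω' h => by simp only [h w (by simp)]) (dependsOn_good _ _ _)
        (by simp [h.irrefl w]), pr_coin_eq]
      refine mul_le_mul_of_nonneg_left (le_pr_good hd ?_ ?_) (by positivity)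
      · exact (card_le_card (erase_subset _ _)).trans (h.card_le w)
      · exact h.le_card_erase hd (h.subset v hw) v)
    (by positivity) hq
  refine (pr_mono fun ω hω => ?_).trans (this.trans (Real.exp_le_exp.mpr (neg_le_neg hq)))
  refine lt_of_le_of_lt ?_ hω
  refine Nat.cast_le.mpr (card_le_card fun w hw => ?_)
  simp only [mem_filter] at hw ⊢
  exact ⟨hw.1, hw.2.1, hw.2.2.mono (erase_subset _ _)⟩

/-- The mean is at most `t + 1`, and a downward fluctuation of `√(#Y) / 256 ≥ 2` suffices. The
cutoff `t + 1` counts ties as removed; the extra `+ 1` leaves room for one erased vertex. -/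
theorem le_pr_card_late [NeZero d] [NeZero N] (hd : 2 ^ 30 ≤ d) {Y : Finset V} (hYd : #Y ≤ d)
    (hY : (d : ℝ) / 2 ≤ #Y) {t : ℕ} (ht : IsMid d t) :
    1 / 2048 ≤ pr fun ω : V → Fin d × Fin N => #{x ∈ Y | ((ω x).1 : ℕ) < t + 1} + 1 ≤ t := by
  have hdR : (2 : ℝ) ^ 30 ≤ d := by exact_mod_cast hd
  have hd0 : (0 : ℝ) < d := by linarith
  have h1 : (d : ℝ) ≤ 4 * t := by exact_mod_cast ht.1
  have h2 : 4 * (t : ℝ) ≤ 3 * d := by exact_mod_cast ht.2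
  have htd : t + 1 ≤ d := by have := ht.2; omega
  have hYR : (#Y : ℝ) ≤ d := by exact_mod_cast hYd
  have hne : Y.Nonempty := by
    rw [← card_pos]
    have : (0 : ℝ) < #Y := by linarith
    exact_mod_cast this
  have hroot : 512 ≤ √(#Y : ℝ) := Real.le_sqrt_of_sq_le (by linarith)
  refine (le_pr_card_filter_le (A := fun a : Fin d × Fin N => (a.1 : ℕ) < t + 1)
    (expect_fst_lt htd) ?_ ?_ hne).trans (pr_mono fun ω hω => ?_)
  · rw [le_div_iff₀ hd0]; push_cast; linarith
  · rw [div_le_iff₀ hd0]; push_cast; linarith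
  · have h3 : ((t + 1 : ℕ) : ℝ) / d * #Y ≤ t + 1 := by
      rw [div_mul_eq_mul_div, div_le_iff₀ hd0]
      push_cast
      exact mul_le_mul_of_nonneg_left hYR (by positivity)
    have : (#{x ∈ Y | ((ω x).1 : ℕ) < t + 1} : ℝ) + 1 ≤ t := by linarith
    exact_mod_cast this

/-- Fix the times on `nb v`, which determine the at least `d / 2 ^ 15` ahead neighbours, and
resample all others. The sets `(nb u).erase v` avoid `nb v` and are pairwise disjoint, so these `u`
are independently late enough, each with probability at least `1/2048`. -/
theorem pr_few_useful_le [NeZero d] [NeZero N] (h : IsNearRegular nb S d) (hd : 2 ^ 30 ≤ d)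
    (v : V) :
    pr (fun ω : V → Fin d × Fin N => Good (√d / 2 ^ 9) (d / 2 ^ 15) (nb v) ω ∧
      (#{u ∈ nb v | Useful nb ω v u} : ℝ) < d / 2 ^ 28) ≤ Real.exp (-(d / 2 ^ 28)) := by
  unfold pr
  rw [expect_piecewise (nb v)]
  refine expect_le univ_nonempty fun ω _ => ?_
  have agree : ∀ ω' : V → Fin d × Fin N, ∀ x ∈ nb v, (nb v).piecewise ω ω' x = ω x :=
    fun ω' x hx => piecewise_eq_of_mem _ _ _ hx
  by_cases hgood : Good (√d / 2 ^ 9) (d / 2 ^ 15) (nb v) ω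
  swap
  · refine (expect_eq_zero fun ω' _ => ?_).le.trans (Real.exp_pos _).le
    rw [if_neg]
    rintro ⟨hg, -⟩
    rw [dependsOn_good _ _ _ fun x hx => agree ω' x (mem_coe.mp hx)] at hg
    exact hgood hg
  set U := {u ∈ nb v | Ahead (√d / 2 ^ 9) (nb v) ω u} with hU
  have hUcard : (d : ℝ) / 2 ^ 15 ≤ #U := hgood
  have hm : (d : ℝ) / 2 ^ 28 ≤ 1 / 2048 * #U / 4 := by linarith
  have := pr_card_filter_lt_le (V := V) (I := U) (D := fun u => (nb u).erase v)
    (q := 1 / 2048) (m := d / 2 ^ 28)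
    (A := fun u (ω' : V → Fin d × Fin N) =>
      #{x ∈ (nb u).erase v | ((ω' x).1 : ℕ) < (ω u).1 + 1} + 1 ≤ ((ω u).1 : ℕ))
    (fun u _ ω₁ ω₂ h => by
      have e : ({x ∈ (nb u).erase v | ((ω₁ x).1 : ℕ) < (ω u).1 + 1} : Finset V) =
          {x ∈ (nb u).erase v | ((ω₂ x).1 : ℕ) < (ω u).1 + 1} :=
        filter_congr fun x hx => by rw [h x (mem_coe.mpr hx)]
      simp only [e])
    (fun u hu w hw huw => h.disjoint_erase (mem_filter.mp hu).1 (mem_filter.mp hw).1 huw)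
    (fun u hu => by
      have hu' := mem_filter.mp hu
      have := h.le_card_erase hd (h.subset v hu'.1) v
      have := sqrt_le_self_div hd
      refine le_pr_card_late hd ((card_le_card (erase_subset _ _)).trans (h.card_le u)) ?_ hu'.2.1
      linarith)
    (by positivity) hm
  refine (pr_mono (V := V) fun ω' hω' => ?_).trans
    (this.trans (Real.exp_le_exp.mpr (neg_le_neg hm)))
  refine lt_of_le_of_lt ?_ hω'.2
  refine Nat.cast_le.mpr (card_le_card fun u hu => ?_)
  simp only [mem_filter (s := U), mem_filter (s := nb v)] at hu ⊢
  obtain ⟨huU, hcount⟩ := hu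
  obtain ⟨huv, hahead⟩ := mem_filter.mp huU
  refine ⟨huv, ?_, ?_⟩
  · have e : ({x ∈ nb v | ((((nb v).piecewise ω ω') x).1 : ℕ) < (((nb v).piecewise ω ω') u).1} :
        Finset V) = {x ∈ nb v | ((ω x).1 : ℕ) < (ω u).1} :=
      filter_congr fun x hx => by rw [agree ω' x hx, agree ω' u huv]
    unfold Ahead
    rw [e, agree ω' u huv]
    exact hahead
  · rw [agree ω' u huv]
    refine le_trans ?_ hcount
    have hsub : ({x ∈ nb u | ((((nb v).piecewise ω ω') x).1 : ℕ) ≤ (ω u).1} : Finset V) ⊆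
        insert v {x ∈ (nb u).erase v | ((ω' x).1 : ℕ) < (ω u).1 + 1} := by
      intro x hx
      rw [mem_filter] at hx
      rw [mem_insert, mem_filter, mem_erase]
      by_cases hxv : x = v
      · exact Or.inl hxv
      · have hx' : x ∉ nb v := disjoint_left.mp (h.triangleFree huv) hx.1
        rw [piecewise_eq_of_notMem _ _ _ hx'] at hx
        exact Or.inr ⟨⟨hxv, hx.1⟩, by omega⟩
    exact (card_le_card hsub).trans (card_insert_le _ _)

theorem IsNearRegular.card_not_disjoint_le (h : IsNearRegular nb S d) (v : V) :
    #{w | ¬ Disjoint (twoBall nb v) (twoBall nb w)} ≤ (d + d * d) * (d + d * d) := by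
  have hsub : ({w | ¬ Disjoint (twoBall nb v) (twoBall nb w)} : Finset V) ⊆
      (twoBall nb v).biUnion (twoBall nb) := by
    intro w hw
    obtain ⟨x, hx, hx'⟩ := not_disjoint_iff.mp (mem_filter.mp hw).2
    exact mem_biUnion.mpr ⟨x, hx, h.mem_twoBall_symm hx'⟩
  exact (card_le_card hsub).trans ((card_biUnion_le_card_mul _ _ _ fun w _ =>
    h.card_twoBall_le w).trans (Nat.mul_le_mul_right _ (h.card_twoBall_le v)))

/-- There are removal times `T` and a set `B` of vertices to be postponed such that every vertex
has about `√d` neighbours in `B`, and every vertex of `B` has linearly many neighbours that can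
save it. -/
theorem IsNearRegular.exists_times (h : IsNearRegular nb S d) (hd : 2 ^ 30 ≤ d)
    (hexp : 48 * (d : ℝ) ^ 4 * Real.exp (-(√d / 2 ^ 32)) ≤ 1) :
    ∃ (T : V → ℕ) (B : Finset V), (∀ v, T v < d) ∧ B ⊆ S ∧
      (∀ v ∈ S, √d / 2 ^ 32 ≤ #{w ∈ nb v | w ∈ B} ∧ #{w ∈ nb v | w ∈ B} ≤ √d / 2 ^ 11) ∧
      ∀ w ∈ B, (d : ℝ) / 2 ^ 28 ≤ #{u ∈ nb w | T u + √d / 2 ^ 9 ≤ #{x ∈ nb w | T x < T u} ∧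
        #{x ∈ nb u | T x ≤ T u} ≤ T u} := by
  have hs := two_pow_le_sqrt hd
  have hsd := sqrt_le_self_div hd
  have : NeZero d := ⟨by omega⟩
  set N := ⌈2 ^ 13 * √(d : ℝ)⌉₊ with hNdef
  have hN1 : 2 ^ 13 * √(d : ℝ) ≤ N := Nat.le_ceil _
  have hN2 : (N : ℝ) ≤ 2 ^ 14 * √d := by
    have := (Nat.ceil_lt_add_one (by positivity : 0 ≤ 2 ^ 13 * √(d : ℝ))).le
    linarith
  have : NeZero N := ⟨by
    intro e
    rw [e] at hN1
    norm_num at hN1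
    linarith⟩
  let manyCoins : V → (V → Fin d × Fin N) → Prop := fun v ω =>
    √d / 2 ^ 11 < (#{w ∈ nb v | (ω w).2 = 0} : ℝ)
  let fewReserved : V → (V → Fin d × Fin N) → Prop := fun v ω =>
    (#{w ∈ nb v | (ω w).2 = 0 ∧ Good (√d / 2 ^ 9) (d / 2 ^ 15) (nb w) ω} : ℝ) < √d / 2 ^ 32
  let fewUseful : V → (V → Fin d × Fin N) → Prop := fun v ω =>
    Good (√d / 2 ^ 9) (d / 2 ^ 15) (nb v) ω ∧ (#{u ∈ nb v | Useful nb ω v u} : ℝ) < d / 2 ^ 28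
  -- The clause `v ∈ S` makes the bad event empty outside `S`, where no lower degree bound is
  -- available.
  have hdep : ∀ v, DependsOn (fun ω => v ∈ S ∧ (manyCoins v ω ∨ fewReserved v ω ∨ fewUseful v ω))
      (twoBall nb v : Set V) := by
    intro v ω ω' hω
    have h1 : ∀ w ∈ nb v, ω w = ω' w := fun w hw => hω w (by
      rw [mem_coe]; exact mem_union_left _ hw)
    have h2 : ∀ w ∈ nb v, ∀ x ∈ nb w, ω x = ω' x := fun w hw x hx => hω x (by
      rw [mem_coe]; exact mem_union_right _ (mem_biUnion.mpr ⟨w, hw, hx⟩))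
    have e1 : manyCoins v ω = manyCoins v ω' := by
      simp only [manyCoins]
      rw [filter_congr fun w hw => by rw [h1 w hw]]
    have e2 : fewReserved v ω = fewReserved v ω' := by
      simp only [fewReserved]
      rw [filter_congr fun w hw => by
        rw [h1 w hw, dependsOn_good _ _ _ fun x hx => h2 w hw x (mem_coe.mp hx)]]
    have hU : ∀ u ∈ nb v, Useful nb ω v u ↔ Useful nb ω' v u := by
      intro u hu
      unfold Useful Ahead
      rw [filter_congr (s := nb v) fun x hx => by rw [h1 x hx, h1 u hu],
        filter_congr (s := nb u) fun x hx => by rw [h2 u hu x hx, h1 u hu], h1 u hu]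
    have e3 : fewUseful v ω = fewUseful v ω' := by
      simp only [fewUseful]
      rw [dependsOn_good _ _ _ fun x hx => h1 x (mem_coe.mp hx), filter_congr hU]
    simp only [e1, e2, e3]
  have hpr : ∀ v, pr (fun ω => v ∈ S ∧ (manyCoins v ω ∨ fewReserved v ω ∨ fewUseful v ω)) ≤
      3 * Real.exp (-(√d / 2 ^ 32)) := by
    intro v
    by_cases hv : v ∈ S
    · have b1 : pr (manyCoins v) ≤ Real.exp (-(√d / 2 ^ 32)) :=
        (pr_many_coins_le h hN1 v).trans (Real.exp_le_exp.mpr (by linarith))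
      have b2 : pr (fewReserved v) ≤ Real.exp (-(√d / 2 ^ 32)) := pr_few_reserved_le h hd hN2 hv
      have b3 : pr (fewUseful v) ≤ Real.exp (-(√d / 2 ^ 32)) :=
        (pr_few_useful_le h hd v).trans (Real.exp_le_exp.mpr (by linarith))
      have o1 := pr_or_le (manyCoins v) (fun ω => fewReserved v ω ∨ fewUseful v ω)
      have o2 := pr_or_le (fewReserved v) (fewUseful v)
      refine (pr_mono fun ω hω => hω.2).trans ?_
      linarith
    · have : pr (fun ω => v ∈ S ∧ (manyCoins v ω ∨ fewReserved v ω ∨ fewUseful v ω)) = 0 :=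
        expect_eq_zero fun ω _ => by simp [hv]
      rw [this]
      positivity
  have hdR : (1 : ℝ) ≤ d := by exact_mod_cast (by omega : 1 ≤ d)
  -- As `Δ ≤ 4 d ^ 4`, the local lemma condition is `4 · 3 exp(…) · 4 d ^ 4 ≤ 1`, which is the
  -- source of the `48` in `hexp`.
  obtain ⟨ω, hω⟩ := exists_forall_not_of_local hdep hpr (Δ := (d + d * d) * (d + d * d))
    (fun v => h.card_not_disjoint_le v) (by nlinarith) (by positivity) (by
      push_cast
      have hE := (Real.exp_pos (-(√(d : ℝ) / 2 ^ 32))).le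
      have hΔ : ((d : ℝ) + d * d) * (d + d * d) ≤ 4 * d ^ 4 := by
        have h1 : (d : ℝ) + d * d ≤ 2 * d ^ 2 := by nlinarith
        calc ((d : ℝ) + d * d) * (d + d * d) ≤ (2 * d ^ 2) * (2 * d ^ 2) := by gcongr
          _ = _ := by ring
      nlinarith [mul_le_mul_of_nonneg_left hΔ hE])
  refine ⟨fun v => (ω v).1, {w ∈ S | (ω w).2 = 0 ∧ Good (√d / 2 ^ 9) (d / 2 ^ 15) (nb w) ω},
    fun v => (ω v).1.isLt, filter_subset _ _, fun v hv => ?_, fun w hw => ?_⟩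
  · have hv' := hω v
    simp only [hv, true_and, not_or] at hv'
    obtain ⟨g1, g2, -⟩ := hv'
    simp only [manyCoins, fewReserved, not_lt] at g1 g2
    constructor
    · refine g2.trans (Nat.cast_le.mpr (card_le_card fun w hw => ?_))
      rw [mem_filter] at hw ⊢
      exact ⟨hw.1, mem_filter.mpr ⟨h.subset v hw.1, hw.2⟩⟩
    · refine le_trans (Nat.cast_le.mpr (card_le_card fun w hw => ?_)) g1
      rw [mem_filter] at hw ⊢
      exact ⟨hw.1, (mem_filter.mp hw.2).2.1⟩
  · rw [mem_filter] at hw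
    have hw' := hω w
    simp only [hw.1, true_and, not_or] at hw'
    obtain ⟨-, -, g3⟩ := hw'
    simp only [fewUseful, hw.2.2, true_and, not_lt] at g3
    refine g3.trans (Nat.cast_le.mpr (card_le_card fun u hu => ?_))
    rw [mem_filter] at hu ⊢
    exact ⟨hu.1, hu.2.1.2, hu.2.2⟩

end RandomOrder

/-! ### Girth conditions, assignment of savers and the final removal order. -/

section Saving

variable {V : Type*}

/-- A graph of girth at least five has no triangles. -/
theorem not_triangle_of_girth {G : SimpleGraph V} (hG : 5 ≤ G.egirth) {a b c : V}
    (hab : G.Adj a b) (hbc : G.Adj b c) (hca : G.Adj c a) : False := by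
  have h := SimpleGraph.le_egirth.mp hG a (.cons hab (.cons hbc (.cons hca .nil))) (by
    have := hab.ne; have := hbc.ne; have := hca.ne
    rw [SimpleGraph.Walk.cons_isCycle_iff]
    simp [SimpleGraph.Walk.isPath_def]
    tauto)
  simp only [SimpleGraph.Walk.length_cons, SimpleGraph.Walk.length_nil] at h
  exact absurd h (by decide)

/-- A graph of girth at least five has no four-cycles. -/
theorem eq_of_girth {G : SimpleGraph V} (hG : 5 ≤ G.egirth) {a b c e : V} (hac : a ≠ c)
    (hab : G.Adj a b) (hbc : G.Adj b c) (hce : G.Adj c e) (hea : G.Adj e a) : b = e := by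
  by_contra hbe
  have h := SimpleGraph.le_egirth.mp hG a
    (.cons hab (.cons hbc (.cons hce (.cons hea .nil)))) (by
    have := hab.ne; have := hbc.ne; have := hce.ne; have := hea.ne
    rw [SimpleGraph.Walk.cons_isCycle_iff]
    simp [SimpleGraph.Walk.isPath_def]
    tauto)
  simp only [SimpleGraph.Walk.length_cons, SimpleGraph.Walk.length_nil] at h
  exact absurd h (by decide)

variable [Fintype V]

/-- If each `w ∈ B` has `k * M` candidates and each candidate serves at most `M` elements of `B`,
then one can assign disjoint sets of `k` candidates to the elements of `B`. -/
theorem exists_disjoint_candidates (B : Finset V) (U : V → Finset V) (k M : ℕ) (hM : 0 < M)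
    (hU : ∀ w ∈ B, k * M ≤ #(U w)) (hB : ∀ u, #{w ∈ B | u ∈ U w} ≤ M) :
    ∃ σ : V → Option V, (∀ u w, σ u = some w → w ∈ B ∧ u ∈ U w) ∧
      ∀ w ∈ B, #{u | σ u = some w} = k := by
  -- Hall's theorem for `k` copies of each element of `B`; its condition follows by double counting
  -- the candidate pairs.
  obtain ⟨f, hf, hfU⟩ := (all_card_le_biUnion_card_iff_exists_injective
    (fun p : B × Fin k => U p.1)).mp (by
      intro s
      set W := s.image fun p => (p.1 : V) with hW
      have hWB : W ⊆ B := by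
        intro w hw
        obtain ⟨p, -, rfl⟩ := mem_image.mp hw
        exact p.1.2
      have h1 : #s ≤ #W * k := by
        have hinj : #s ≤ #(W ×ˢ (univ : Finset (Fin k))) := by
          refine card_le_card_of_injOn (fun p => ((p.1 : V), p.2)) (fun p hp => ?_) ?_
          · rw [mem_coe, mem_product]
            exact ⟨mem_image_of_mem _ hp, mem_univ _⟩
          · rintro ⟨p, i⟩ _ ⟨q, j⟩ _ e
            have e' := Prod.ext_iff.mp e
            exact Prod.ext (Subtype.ext e'.1) e'.2
        simpa using hinj
      have h2 : #W * (k * M) ≤ #(s.biUnion fun p => U p.1) * M := by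
        refine card_mul_le_card_mul (fun w u => u ∈ U w) (fun w hw => ?_) fun u _ => ?_
        · refine (hU w (hWB hw)).trans (card_le_card fun u hu => ?_)
          obtain ⟨p, hp, rfl⟩ := mem_image.mp hw
          exact (mem_bipartiteAbove _).mpr ⟨mem_biUnion.mpr ⟨p, hp, hu⟩, hu⟩
        · exact (card_le_card (filter_subset_filter _ hWB)).trans (hB u)
      rw [← mul_assoc] at h2
      exact h1.trans (Nat.le_of_mul_le_mul_right h2 hM))
  refine ⟨fun u => if h : ∃ p, f p = u then some h.choose.1 else none, ?_, ?_⟩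
  · intro u w h
    simp only at h
    split_ifs at h with hp
    · have hp' := hp.choose_spec
      rw [Option.some.injEq] at h
      rw [← h]
      exact ⟨hp.choose.1.2, by simpa only [hp'] using hfU hp.choose⟩
  · intro w hw
    have e : ({u | (if h : ∃ p, f p = u then some (h.choose.1 : V) else none) = some w} :
        Finset V) = univ.image fun i : Fin k => f (⟨w, hw⟩, i) := by
      ext u
      simp only [mem_filter, mem_univ, true_and, mem_image]
      constructor
      · intro h
        split_ifs at h with hp
        · rw [Option.some.injEq] at h
          refine ⟨hp.choose.2, ?_⟩
          refine Eq.trans (congrArg f ?_) hp.choose_spec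
          exact Prod.ext (Subtype.ext h.symm) rfl
      · rintro ⟨i, rfl⟩
        have hp : ∃ p, f p = f (⟨w, hw⟩, i) := ⟨_, rfl⟩
        rw [dif_pos hp, hf hp.choose_spec]
    rw [e, card_image_of_injective _ fun i j hij => by simpa using hf hij]
    simp

/-- The neighbourhoods in an induced subgraph of minimum degree close to `d`. -/
theorem isNearRegular_of_girth {G : SimpleGraph V} (hG : 5 ≤ G.egirth) {S : Finset V} {d : ℕ}
    (hle : ∀ v, (G.neighborSet v).ncard ≤ d)
    (hge : ∀ v ∈ S, (d : ℝ) - √d / 2 ^ 13 ≤ #{x ∈ S | G.Adj x v}) :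
    IsNearRegular (fun v => {x ∈ S | G.Adj x v ∧ v ∈ S}) S d where
  symm {u v} h := by
    simp only [mem_filter] at h ⊢
    exact ⟨h.2.2, h.2.1.symm, h.1⟩
  irrefl v h := by simp at h
  triangleFree {u w} h := by
    rw [disjoint_left]
    intro x hx hx'
    simp only [mem_filter] at h hx hx'
    exact not_triangle_of_girth hG hx.2.1 h.2.1 hx'.2.1.symm
  squareFree {u w x y} huw h1 h2 h3 h4 := by
    simp only [mem_filter] at h1 h2 h3 h4
    exact eq_of_girth hG huw h1.2.1.symm h2.2.1 h4.2.1.symm h3.2.1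
  subset v := filter_subset _ _
  card_le v := by
    rw [← Set.ncard_coe_finset]
    refine (Set.ncard_le_ncard fun x hx => ?_).trans (hle v)
    exact (mem_filter.mp (mem_coe.mp hx)).2.1.symm
  le_card v hv := by simpa [hv] using hge v hv

/-- Removal of an induced subgraph of minimum degree more than `d - k`. -/
theorem removal_of_girth {G : SimpleGraph V} (hG : 5 ≤ G.egirth) {S : Finset V} {d k : ℕ}
    (hd : 2 ^ 66 ≤ d) (hexp : 48 * (d : ℝ) ^ 4 * Real.exp (-(√d / 2 ^ 32)) ≤ 1)
    (hk : (k : ℝ) ≤ √d / 2 ^ 32) (hle : ∀ v, (G.neighborSet v).ncard ≤ d)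
    (hge : ∀ v ∈ S, d - k < #{x ∈ S | G.Adj x v}) :
    ∃ g : V → ℤ, Relation.ReflTransGen (LegalStep G)
      ((S : Set V), fun _ => ((d - k : ℕ) : ℤ)) (∅, g) := by
  have hd30 : 2 ^ 30 ≤ d := le_trans (by norm_num) hd
  have hs : (2 : ℝ) ^ 33 ≤ √d := by
    apply Real.le_sqrt_of_sq_le
    have : (2 : ℝ) ^ 66 ≤ d := by exact_mod_cast hd
    linarith
  have hsq : √(d : ℝ) ^ 2 = d := Real.sq_sqrt (Nat.cast_nonneg _)
  have hkd : k ≤ d := by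
    have : (k : ℝ) ≤ d := by nlinarith
    exact_mod_cast this
  have hreg : IsNearRegular (fun v => {x ∈ S | G.Adj x v ∧ v ∈ S}) S d :=
    isNearRegular_of_girth hG hle fun v hv => by
      have h1 : d < #{x ∈ S | G.Adj x v} + k := by have := hge v hv; omega
      have h2 : (d : ℝ) < #{x ∈ S | G.Adj x v} + k := by exact_mod_cast h1
      linarith
  set nb : V → Finset V := fun v => {x ∈ S | G.Adj x v ∧ v ∈ S} with hnb
  have mem_nb : ∀ {x v}, x ∈ nb v ↔ x ∈ S ∧ G.Adj x v ∧ v ∈ S := fun {x v} => by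
    simp only [hnb, mem_filter]
  obtain ⟨T, B, hT, hBS, hdeg, huse⟩ := hreg.exists_times hd30 hexp
  set M := ⌊√(d : ℝ) / 2 ^ 11⌋₊ with hM
  have hMle : (M : ℝ) ≤ √d / 2 ^ 11 := Nat.floor_le (by positivity)
  have hMpos : 0 < M := Nat.floor_pos.mpr (by linarith)
  set U : V → Finset V := fun w => {u ∈ nb w | u ∉ B ∧ T u + √d / 2 ^ 9 ≤
    (#{x ∈ nb w | T x < T u} : ℝ) ∧ #{x ∈ nb u | T x ≤ T u} ≤ T u} with hUdef
  have mem_U : ∀ {u w}, u ∈ U w ↔ u ∈ nb w ∧ u ∉ B ∧ T u + √d / 2 ^ 9 ≤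
      (#{x ∈ nb w | T x < T u} : ℝ) ∧ #{x ∈ nb u | T x ≤ T u} ≤ T u := fun {u w} => by
    simp only [hUdef, mem_filter]
  -- Discarding candidates in `B` costs at most `√d / 2 ^ 11`, and `k * M ≤ d / 2 ^ 43`; both are
  -- small against `d / 2 ^ 28`.
  have hUcard : ∀ w ∈ B, k * M ≤ #(U w) := by
    intro w hw
    have h1 := huse w hw
    have h2 := (hdeg w (hBS hw)).2
    have h3 : #{u ∈ nb w | T u + √d / 2 ^ 9 ≤ (#{x ∈ nb w | T x < T u} : ℝ) ∧
        #{x ∈ nb u | T x ≤ T u} ≤ T u} ≤ #(U w) + #{u ∈ nb w | u ∈ B} := by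
      refine (card_le_card fun u hu => ?_).trans (card_union_le _ _)
      rw [mem_filter] at hu
      rw [mem_union]
      by_cases huB : u ∈ B
      · exact Or.inr (mem_filter.mpr ⟨hu.1, huB⟩)
      · exact Or.inl (mem_U.mpr ⟨hu.1, huB, hu.2⟩)
    have h4 : (#{u ∈ nb w | T u + √d / 2 ^ 9 ≤ (#{x ∈ nb w | T x < T u} : ℝ) ∧
        #{x ∈ nb u | T x ≤ T u} ≤ T u} : ℝ) ≤ #(U w) + #{u ∈ nb w | u ∈ B} := by
      exact_mod_cast h3
    have h5 : (k : ℝ) * M ≤ √d / 2 ^ 32 * (√d / 2 ^ 11) := by gcongr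
    have h6 : (k * M : ℝ) ≤ #(U w) := by nlinarith
    exact_mod_cast h6
  have hUdeg : ∀ u, #{w ∈ B | u ∈ U w} ≤ M := by
    intro u
    by_cases hu : u ∈ S
    · rw [hM]
      refine Nat.le_floor (le_trans (Nat.cast_le.mpr (card_le_card fun w hw => ?_)) (hdeg u hu).2)
      rw [mem_filter] at hw ⊢
      exact ⟨hreg.symm (mem_U.mp hw.2).1, hw.1⟩
    · rw [filter_eq_empty_iff.mpr fun w _ hw => hu (mem_nb.mp (mem_U.mp hw).1).1]
      simp
  -- Exactly `k` savers: at least `k` keeps the budget of `w` nonnegative, at most `k` keeps `w`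
  -- behind its savers.
  obtain ⟨σ, hσ, hσcard⟩ := exists_disjoint_candidates B U k M hMpos hUcard hUdeg
  -- All of `B` comes after everything else, since `T < d`; ties in `τ` are broken by an enumeration
  -- of `V`.
  let τ : V → ℕ := fun x => if x ∈ B then d else T x
  have τB : ∀ {x}, x ∈ B → τ x = d := fun h => if_pos h
  have τT : ∀ {x}, x ∉ B → τ x = T x := fun h => if_neg h
  let e := Fintype.equivFin V
  let r : V → ℕ ×ₗ Fin (Fintype.card V) := fun x => toLex (τ x, e x)
  have r_lt : ∀ {x y}, τ x < τ y → r x < r y := fun h => Prod.Lex.toLex_lt_toLex.mpr (Or.inl h)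
  have τ_le : ∀ {x y}, r x < r y → τ x ≤ τ y := fun h => by
    rcases Prod.Lex.toLex_lt_toLex.mp h with h | h
    · exact h.le
    · exact h.1.le
  have hr : Set.InjOn r S := fun x _ y _ h => by
    have : (τ x, e x) = (τ y, e y) := toLex.injective h
    exact e.injective (Prod.ext_iff.mp this).2
  have early : ∀ {x u}, u ∉ B → r x < r u → x ∉ B ∧ T x ≤ T u := by
    intro x u hu hxu
    have h1 := τ_le hxu
    rw [τT hu] at h1
    have hxB : x ∉ B := fun hx => by
      rw [τB hx] at h1
      exact absurd (hT u) (not_lt.mpr h1)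
    exact ⟨hxB, by rwa [τT hxB] at h1⟩
  have hkB : ∀ v ∈ S, k ≤ #{w ∈ nb v | w ∈ B} := fun v hv => by
    exact_mod_cast hk.trans (hdeg v hv).1
  refine removal_of_order G _ σ S r hr ?_ ?_
  · intro u hu w huw
    obtain ⟨hwB, huU⟩ := hσ u w huw
    obtain ⟨hunb, huB, hahead, hlate⟩ := mem_U.mp huU
    refine ⟨hBS hwB, (mem_nb.mp hunb).2.1, r_lt ?_, ?_⟩
    · rw [τT huB, τB hwB]; exact hT u
    unfold budget
    have h1 : #{x ∈ ({x ∈ S | r x < r u} : Finset V) | G.Adj x u ∧ σ x ≠ some u} ≤ T u := by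
      refine (card_le_card fun x hx => ?_).trans hlate
      simp only [mem_filter] at hx ⊢
      exact ⟨mem_nb.mpr ⟨hx.1.1, hx.2.1, hu⟩, (early huB hx.1.2).2⟩
    -- Of the neighbours of `w` with earlier times, only those in `B` and its savers have not cost
    -- it anything. They number at most `√d / 2 ^ 11 + √d / 2 ^ 32`, less than the surplus `√d / 2 ^
    -- 9`.
    have h2 : #{x ∈ nb w | T x < T u} ≤
        #{x ∈ ({x ∈ S | r x < r u} : Finset V) | G.Adj x w ∧ σ x ≠ some w} +
          (#{x ∈ nb w | x ∈ B} + k) := by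
      rw [← hσcard w hwB]
      refine (card_le_card fun x hx => ?_).trans ((card_union_le _ _).trans
        (Nat.add_le_add_left (card_union_le _ _) _))
      simp only [mem_filter, mem_union, mem_univ, true_and] at hx ⊢
      by_cases hxB : x ∈ B
      · exact Or.inr (Or.inl ⟨hx.1, hxB⟩)
      by_cases hxσ : σ x = some w
      · exact Or.inr (Or.inr hxσ)
      refine Or.inl ⟨⟨(mem_nb.mp hx.1).1, r_lt ?_⟩, (mem_nb.mp hx.1).2.1, hxσ⟩
      rw [τT hxB, τT huB]; exact hx.2
    have h3 : (#{x ∈ nb w | T x < T u} : ℝ) ≤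
        #{x ∈ ({x ∈ S | r x < r u} : Finset V) | G.Adj x w ∧ σ x ≠ some w} +
          (#{x ∈ nb w | x ∈ B} + k) := by exact_mod_cast h2
    have h4 := (hdeg w (hBS hwB)).2
    have h5 : (T u : ℝ) <
        #{x ∈ ({x ∈ S | r x < r u} : Finset V) | G.Adj x w ∧ σ x ≠ some w} := by linarith
    have h6 : T u <
        #{x ∈ ({x ∈ S | r x < r u} : Finset V) | G.Adj x w ∧ σ x ≠ some w} := by
      exact_mod_cast h5
    omega
  · intro v hv
    unfold budget
    -- At least `k` neighbours of `v` cost it nothing: its savers if `v ∈ B`, its neighbours still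
    -- waiting in `B` otherwise.
    suffices h : #{x ∈ ({x ∈ S | r x < r v} : Finset V) | G.Adj x v ∧ σ x ≠ some v} + k ≤ d by
      omega
    refine le_trans ?_ (hreg.card_le v)
    by_cases hvB : v ∈ B
    · rw [← hσcard v hvB, ← card_union_of_disjoint]
      · refine card_le_card fun x hx => ?_
        simp only [mem_filter, mem_union, mem_univ, true_and] at hx
        rcases hx with hx | hx
        · exact mem_nb.mpr ⟨hx.1.1, hx.2.1, hv⟩
        · exact (mem_U.mp (hσ x v hx).2).1
      · rw [disjoint_left]
        intro x hx hx'
        exact (mem_filter.mp hx).2.2 (mem_filter.mp hx').2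
    · refine (Nat.add_le_add_left (hkB v hv) _).trans ?_
      rw [← card_union_of_disjoint]
      · refine card_le_card fun x hx => ?_
        simp only [mem_filter, mem_union] at hx
        rcases hx with hx | hx
        · exact mem_nb.mpr ⟨hx.1.1, hx.2.1, hv⟩
        · exact hx.1
      · rw [disjoint_left]
        intro x hx hx'
        exact (early hvB (mem_filter.mp (mem_filter.mp hx).1).2).1 (mem_filter.mp hx').2

theorem eventually_pow_mul_exp_le :
    ∀ᶠ d : ℕ in Filter.atTop, 48 * (d : ℝ) ^ 4 * Real.exp (-(√d / 2 ^ 32)) ≤ 1 := by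
  have h1 : Filter.Tendsto (fun d : ℕ => √(d : ℝ) / 2 ^ 32) Filter.atTop Filter.atTop :=
    (Real.tendsto_sqrt_atTop.comp tendsto_natCast_atTop_atTop).atTop_div_const (by positivity)
  -- With `y = √d / 2 ^ 32` one has `d ^ 4 = 2 ^ 256 * y ^ 8`.
  have h2 := ((Real.tendsto_pow_mul_exp_neg_atTop_nhds_zero 8).comp h1).const_mul
    (48 * 2 ^ 256 : ℝ)
  rw [mul_zero] at h2
  filter_upwards [h2.eventually_le_const one_pos] with d hd
  refine le_trans (le_of_eq ?_) hd
  have hsq : √(d : ℝ) ^ 2 = d := Real.sq_sqrt (Nat.cast_nonneg _)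
  have : (d : ℝ) ^ 4 = √(d : ℝ) ^ 8 := by
    rw [show √(d : ℝ) ^ 8 = (√(d : ℝ) ^ 2) ^ 4 by ring, hsq]
  simp only [Function.comp]
  rw [this]
  ring

end Saving

end WeakDegeneracy


theorem theorem1p10 :
    ∃ c : ℝ, 0 < c ∧ ∃ d₀ : ℕ,
      ∀ (V : Type*) [Fintype V] (G : SimpleGraph V) [DecidableRel G.Adj] (d : ℕ),
        d₀ ≤ d → G.maxDegree = d → 5 ≤ G.egirth →
          (WeakDegeneracy.weakDegeneracy G : ℝ) ≤ (d : ℝ) - c * Real.sqrt (d : ℝ) := by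
  obtain ⟨d₁, hd₁⟩ := Filter.eventually_atTop.mp WeakDegeneracy.eventually_pow_mul_exp_le
  -- From `d ≥ 2 ^ 66` one gets `√d / 2 ^ 33 ≥ 1`, so rounding up to the integer `k` at most doubles
  -- it and `k ≤ √d / 2 ^ 32`.
  refine ⟨1 / 2 ^ 33, by positivity, max d₁ (2 ^ 66), fun V _ G _ d hd hmax hgirth => ?_⟩
  have hd66 : 2 ^ 66 ≤ d := (le_max_right _ _).trans hd
  have hs : (2 : ℝ) ^ 33 ≤ √d := by
    apply Real.le_sqrt_of_sq_le
    have : (2 : ℝ) ^ 66 ≤ d := by exact_mod_cast hd66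
    linarith
  have hsq : √(d : ℝ) ^ 2 = d := Real.sq_sqrt (Nat.cast_nonneg _)
  set k := ⌈1 / 2 ^ 33 * √(d : ℝ)⌉₊ with hk
  have hk1 : 1 / 2 ^ 33 * √(d : ℝ) ≤ k := Nat.le_ceil _
  have hk2 : (k : ℝ) ≤ √d / 2 ^ 32 := by
    have := (Nat.ceil_lt_add_one (by positivity : 0 ≤ 1 / 2 ^ 33 * √(d : ℝ))).le
    rw [← hk] at this
    linarith
  have hkd : k ≤ d := by
    have : (k : ℝ) ≤ d := by nlinarith
    exact_mod_cast this
  have hdeg : ∀ v, (G.neighborSet v).ncard ≤ d := fun v => by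
    rw [← hmax, Set.ncard_eq_toFinset_card']
    exact G.degree_le_maxDegree v
  have hwd : WeakDegeneracy.IsWeaklyDegenerate G fun _ => d - k := by
    obtain ⟨g, hg⟩ := WeakDegeneracy.removal_of_core G (d - k)
      (fun S hS => WeakDegeneracy.removal_of_girth hgirth hd66
        (hd₁ d ((le_max_left _ _).trans hd)) hk2 hdeg hS) Finset.univ
    exact ⟨g, by simpa only [Finset.coe_univ] using hg⟩
  have hle : WeakDegeneracy.weakDegeneracy G ≤ d - k := Nat.sInf_le hwd
  have hle' : (WeakDegeneracy.weakDegeneracy G : ℝ) ≤ ((d - k : ℕ) : ℝ) := by exact_mod_cast hle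
  rw [Nat.cast_sub hkd] at hle'
  linarith
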